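/- Let $\mathfrak n$ be a real Lie algebra of dimension $8$ which is filiform, i.e. nilpotent of step exactly $7$, and which admits an $\mathbb N$-gradation, i.e. a vector space decomposition $\mathfrak n=\bigoplus_{i\ge 1}\mathfrak n_i$ indexed by the positive integers such that $[\mathfrak n_i,\mathfrak n_j]\subseteq\mathfrak n_{i+j}$ for all $i,j\geq 1$. Then $\mathfrak n$ is isomorphic, as a real Lie algebra, to one and only one of the following Lie algebras $(\mathbb R^8,\mu)$, where different values of the parameter $\alpha$ (respectively $t$) count as different algebras of the list. Conversely, each algebra of the list is an $8$-dimensional filiform real Lie algebra that admits an $\mathbb N$-gradation. Here $e_1,\dots,e_8$ is the standard basis of $\mathbb R^8$, $\mu$ is bilinear and skew-symmetric, and the brackets $\mu(e_i,e_j)$ that are not determined by those listed and by skew-symmetry are zero. Algebras with $\mu(e_1,e_i)=e_{i+1}$ for $i=2,\dots,7$ and, in addition: - $\mathfrak m_0(8)$: no further brackets; - $\mathfrak m_1(8)$: $\mu(e_i,e_{9-i})=(-1)^i e_8$ for $i=2,\dots,7$; - $\mathfrak m_2(8)$: $\mu(e_2,e_i)=e_{i+2}$ for $i=3,\dots,6$;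 - $\mathfrak g_\alpha(8)$, $\alpha\in\mathbb R$: $\mu(e_2,e_3)=(2+\alpha)e_5$, $\mu(e_2,e_4)=(2+\alpha)e_6$, $\mu(e_2,e_5)=(1+\alpha)e_7$, $\mu(e_2,e_6)=\alpha e_8$, $\mu(e_3,e_4)=e_7$, $\mu(e_3,e_5)=e_8$; - $\mathfrak a_t(8)$, $t\in\mathbb R$: $\mu(e_2,e_3)=(t+1)e_6$, $\mu(e_2,e_4)=(t+1)e_7$, $\mu(e_2,e_5)=t e_8$, $\mu(e_3,e_4)=e_8$; - $\mathfrak c_{1,0}(8)$: $\mu(e_2,e_3)=e_6$, $\mu(e_2,e_4)=e_7$, $\mu(e_2,e_5)=e_8$; - $\mathfrak d_1(8)$: $\mu(e_2,e_3)=e_7$, $\mu(e_2,e_4)=e_8$; - $\mathfrak h_1(8)$: $\mu(e_2,e_3)=e_8$. Algebras with $\mu(e_1,e_i)=e_{i+1}$ for $i=2,\dots,6$ and $\mu(e_i,e_{9-i})=(-1)^{i+1}e_8$ for $i=2,3,4$ and, in addition: - $\mathfrak b(8)$: $\mu(e_2,e_3)=-\tfrac12 e_5$, $\mu(e_2,e_4)=-\tfrac12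 e_6$, $\mu(e_2,e_5)=-\tfrac32 e_7$, $\mu(e_3,e_4)=e_7$; - $\mathfrak k_1(8)$: $\mu(e_2,e_3)=e_6$, $\mu(e_2,e_4)=e_7$; - $\mathfrak s_1(8)$: $\mu(e_2,e_3)=e_7$. -/

import Mathlib

namespace FiliformGraded

/-- A finite-dimensional real Lie algebra of dimension `n` is filiform if it is nilpotent of step
exactly `n - 1`: in the descending central series `C₀ = L`, `Cᵢ₊₁ = [L, Cᵢ]`, the first term that
vanishes is `Cₙ₋₁`. -/
def IsFiliform (L : Type*) [LieRing L] [LieAlgebra ℝ L] : Prop :=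
  FiniteDimensional ℝ L ∧ LieRing.IsNilpotent L ∧
    LieModule.nilpotencyLength L L + 1 = Module.finrank ℝ L

/-- An `ℕ`-gradation of a real Lie algebra, the degrees being positive integers: a direct sum
decomposition `L = ⨁ 𝒱 i` into subspaces such that `⁅𝒱 i, 𝒱 j⁆ ⊆ 𝒱 (i + j)`. (If `L` is
finite-dimensional, only finitely many `𝒱 i` are nonzero.) -/
def AdmitsNGradation (L : Type*) [LieRing L] [LieAlgebra ℝ L] : Prop :=
  ∃ 𝒱 : ℕ+ → Submodule ℝ L, DirectSum.IsInternal 𝒱 ∧ SetLike.GradedBracket 𝒱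

/-- The names of the algebras of the table, the members of the two curves being listed
separately for each value of the real parameter. -/
inductive TableName : Type
  | m0
  | m1
  | m2
  | g (α : ℝ)
  | a (t : ℝ)
  | c10
  | d1
  | h1
  | b
  | k1
  | s1

/-- A bracket relation `μ(e_i, e_j) = c e_k`, with `1 ≤ i < j ≤ 8` and `1 ≤ k ≤ 8`. -/
structure Relation where
  i : ℕ
  j : ℕ
  c : ℝ
  k : ℕ

/-- The relations `μ(e_1, e_i) = e_{i+1}` for `i = 2, …, 6`. -/
noncomputable def chain6 : List Relation :=
  [⟨1, 2, 1, 3⟩, ⟨1, 3, 1, 4⟩, ⟨1, 4, 1, 5⟩, ⟨1, 5, 1, 6⟩, ⟨1, 6, 1, 7⟩]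

/-- The relations `μ(e_1, e_i) = e_{i+1}` for `i = 2, …, 7`. -/
noncomputable def chain7 : List Relation := chain6 ++ [⟨1, 7, 1, 8⟩]

/-- The nonzero brackets `μ(e_i, e_j)`, `i < j`, of the algebras of the table. -/
noncomputable def relations : TableName → List Relation
  | .m0 => chain7
  | .m1 => chain7 ++ [⟨2, 7, 1, 8⟩, ⟨3, 6, -1, 8⟩, ⟨4, 5, 1, 8⟩]
  | .m2 => chain7 ++ [⟨2, 3, 1, 5⟩, ⟨2, 4, 1, 6⟩, ⟨2, 5, 1, 7⟩, ⟨2, 6, 1, 8⟩]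
  | .g α => chain7 ++ [⟨2, 3, 2 + α, 5⟩, ⟨2, 4, 2 + α, 6⟩, ⟨2, 5, 1 + α, 7⟩, ⟨2, 6, α, 8⟩,
      ⟨3, 4, 1, 7⟩, ⟨3, 5, 1, 8⟩]
  | .a t => chain7 ++ [⟨2, 3, t + 1, 6⟩, ⟨2, 4, t + 1, 7⟩, ⟨2, 5, t, 8⟩, ⟨3, 4, 1, 8⟩]
  | .c10 => chain7 ++ [⟨2, 3, 1, 6⟩, ⟨2, 4, 1, 7⟩, ⟨2, 5, 1, 8⟩]
  | .d1 => chain7 ++ [⟨2, 3, 1, 7⟩, ⟨2, 4, 1, 8⟩]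
  | .h1 => chain7 ++ [⟨2, 3, 1, 8⟩]
  | .b => chain6 ++ [⟨2, 3, -1 / 2, 5⟩, ⟨2, 4, -1 / 2, 6⟩, ⟨2, 5, -3 / 2, 7⟩, ⟨3, 4, 1, 7⟩,
      ⟨2, 7, -1, 8⟩, ⟨3, 6, 1, 8⟩, ⟨4, 5, -1, 8⟩]
  | .k1 => chain6 ++ [⟨2, 3, 1, 6⟩, ⟨2, 4, 1, 7⟩, ⟨2, 7, -1, 8⟩, ⟨3, 6, 1, 8⟩, ⟨4, 5, -1, 8⟩]
  | .s1 => chain6 ++ [⟨2, 3, 1, 7⟩, ⟨2, 7, -1, 8⟩, ⟨3, 6, 1, 8⟩, ⟨4, 5, -1, 8⟩]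

/-- The position in `Fin 8` (which counts from `0`) of the `i`-th coordinate, `1 ≤ i ≤ 8`. -/
def pos (i : ℕ) : Fin 8 := Fin.ofNat 8 (i - 1)

/-- The basis vector `e_k` of `ℝ⁸`, `1 ≤ k ≤ 8`. -/
noncomputable def e (k : ℕ) : Fin 8 → ℝ := Pi.single (pos k) 1

/-- The skew-symmetric bilinear map on `ℝ⁸` with `μ(e_i, e_j) = c e_k = -μ(e_j, e_i)` for each
listed relation and `μ(e_i, e_j) = 0` for the other pairs. -/
noncomputable def mu (l : List Relation) (x y : Fin 8 → ℝ) : Fin 8 → ℝ :=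
  (l.map fun r => (r.c * (x (pos r.i) * y (pos r.j) - x (pos r.j) * y (pos r.i))) • e r.k).sum

theorem mu_add_left (l : List Relation) (x y z : Fin 8 → ℝ) :
    mu l (x + y) z = mu l x z + mu l y z := by
  simp only [mu, ← List.sum_map_add]
  congr 2
  funext r
  rw [← add_smul]
  congr 1
  simp only [Pi.add_apply]
  ring

theorem mu_swap (l : List Relation) (x y : Fin 8 → ℝ) : mu l x y = - mu l y x := by
  induction l with
  | nil => simp [mu]
  | cons r l ih =>
    simp only [mu, List.map_cons, List.sum_cons] at ih ⊢
    rw [ih, neg_add, ← neg_smul]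
    congr 2
    ring

theorem mu_add_right (l : List Relation) (x y z : Fin 8 → ℝ) :
    mu l x (y + z) = mu l x y + mu l x z := by
  rw [mu_swap, mu_add_left, neg_add, ← mu_swap, ← mu_swap]

theorem mu_self (l : List Relation) (x : Fin 8 → ℝ) : mu l x x = 0 := by
  have h (r : Relation) : x (pos r.i) * x (pos r.j) - x (pos r.j) * x (pos r.i) = 0 := by ring
  simp [mu, h]

theorem mu_smul_right (l : List Relation) (c : ℝ) (x y : Fin 8 → ℝ) :
    mu l x (c • y) = c • mu l x y := by
  induction l with
  | nil => simp [mu]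
  | cons r l ih =>
    simp only [mu, List.map_cons, List.sum_cons] at ih ⊢
    rw [ih, smul_add, smul_smul]
    congr 2
    simp only [Pi.smul_apply, smul_eq_mul]
    ring

theorem mu_nil (x y : Fin 8 → ℝ) (m : Fin 8) : mu [] x y m = 0 := by simp [mu]

theorem mu_cons (r : Relation) (l : List Relation) (x y : Fin 8 → ℝ) (m : Fin 8) :
    mu (r :: l) x y m =
      (if m = pos r.k then r.c * (x (pos r.i) * y (pos r.j) - x (pos r.j) * y (pos r.i)) else 0) +
        mu l x y m := by
  simp [mu, e, Pi.single_apply]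

set_option linter.unusedSimpArgs false in
set_option maxHeartbeats 4000000 in
theorem mu_jacobi (s : TableName) (x y z : Fin 8 → ℝ) :
    mu (relations s) x (mu (relations s) y z) =
      mu (relations s) (mu (relations s) x y) z + mu (relations s) y (mu (relations s) x z) := by
  have p1 : pos 1 = 0 := rfl
  have p2 : pos 2 = 1 := rfl
  have p3 : pos 3 = 2 := rfl
  have p4 : pos 4 = 3 := rfl
  have p5 : pos 5 = 4 := rfl
  have p6 : pos 6 = 5 := rfl
  have p7 : pos 7 = 6 := rfl
  have p8 : pos 8 = 7 := rfl
  have h0 (s) (x y : Fin 8 → ℝ) : mu (relations s) x y 0 = 0 := by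
    cases s <;> simp [relations, chain7, chain6, mu_cons, mu_nil, p3, p4, p5, p6, p7, p8]
  have h1 (s) (x y : Fin 8 → ℝ) : mu (relations s) x y 1 = 0 := by
    cases s <;> simp [relations, chain7, chain6, mu_cons, mu_nil, p3, p4, p5, p6, p7, p8]
  have h2 (s) (x y : Fin 8 → ℝ) : mu (relations s) x y 2 = x 0 * y 1 - x 1 * y 0 := by
    cases s <;> simp [relations, chain7, chain6, mu_cons, mu_nil, p1, p2, p3, p4, p5, p6, p7, p8]
  have h3 (s) (x y : Fin 8 → ℝ) : mu (relations s) x y 3 = x 0 * y 2 - x 2 * y 0 := by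
    cases s <;> simp [relations, chain7, chain6, mu_cons, mu_nil, p1, p2, p3, p4, p5, p6, p7, p8]
  ext m
  cases s <;> fin_cases m
  all_goals
    simp only [Pi.add_apply, Fin.mk_zero, Fin.mk_one, Fin.reduceFinMk, Fin.zero_eta,
      Fin.isValue, h0, h1, h2, h3]
    try simp only [relations, chain7, chain6, List.cons_append, List.nil_append, mu_cons, mu_nil,
      p1, p2, p3, p4, p5, p6, p7, p8, Fin.reduceEq, if_true, if_false, Fin.isValue, h0, h1, h2, h3]
    first | done | ring

/-- The underlying vector space `ℝ⁸` of the algebra of the table with the given name. -/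
def TableAlgebra (_ : TableName) : Type := Fin 8 → ℝ

noncomputable instance (s : TableName) : AddCommGroup (TableAlgebra s) :=
  inferInstanceAs (AddCommGroup (Fin 8 → ℝ))

noncomputable instance (s : TableName) : Module ℝ (TableAlgebra s) :=
  inferInstanceAs (Module ℝ (Fin 8 → ℝ))

noncomputable instance (s : TableName) : LieRing (TableAlgebra s) where
  bracket x y := mu (relations s) x y
  add_lie x y z := mu_add_left (relations s) x y z
  lie_add x y z := mu_add_right (relations s) x y z
  lie_self x := mu_self (relations s) x
  leibniz_lie x y z := mu_jacobi s x y z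

noncomputable instance (s : TableName) : LieAlgebra ℝ (TableAlgebra s) where
  lie_smul c x y := mu_smul_right (relations s) c x y

end FiliformGraded

/-! ### A common family of brackets and its adapted bases -/

namespace FiliformGraded

/-! A gradation in positive degrees gives a derivation `D` acting on each piece by its degree, so
`L` is spanned by eigenvectors of positive weight. Filiformity forces the commutator ideal to have
codimension two and the later quotients of the lower central series to be lines, so two eigenvectors
`x`, `y` of weights `p`, `q` generate `L`. They can be chosen with `⁅y, ⁅x, y⁆⁆` in `lcs L 3`, and
then `LcsFiliform.chain` shows that repeated brackets of `x` with `y` reach every quotient except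
possibly the last.

The last basis vector is `⁅x, z₇⁆` if this is nonzero (`ε = 1`), and `-⁅y, z₇⁆` otherwise (`ε = 0`,
`η = -1`). The Jacobi identity with `f 0` reduces the bracket to the few constants in `Params` (the
structure `Adapted`). Comparing weights with `r = q / p`, a nonzero `a_k` or `b_k` forces `r = k`,
and a nonzero `η` forces `r = 1` when `ε = 1`. So only constants of one index survive, and rescaling
brings them to an entry of the table.

For uniqueness, an isomorphism is triangular for the adapted bases. By `Adapted.compare` the leading
constants of index `k` change by the factor `x ^ k / y`, with `x`, `y` the first two diagonal
entries. Their vanishing, and the ratio of `a_k` to `b_k` on each curve, are therefore invariant. -/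

/-- Structure constants of a family of skew-symmetric brackets on `ℝ⁸` that contains the
brackets of all the algebras of the table. -/
structure Params where
  ε : ℝ
  η : ℝ
  a2 : ℝ
  b2 : ℝ
  a3 : ℝ
  b3 : ℝ
  a4 : ℝ
  a5 : ℝ

/-- The bracket on `ℝ⁸` with the given structure constants. -/
noncomputable def Params.bracket (P : Params) (x y : Fin 8 → ℝ) : Fin 8 → ℝ :=
  ![0, 0, x 0 * y 1 - x 1 * y 0, x 0 * y 2 - x 2 * y 0,
    (x 0 * y 3 - x 3 * y 0) + P.a2 * (x 1 * y 2 - x 2 * y 1),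
    (x 0 * y 4 - x 4 * y 0) + P.a2 * (x 1 * y 3 - x 3 * y 1) + P.a3 * (x 1 * y 2 - x 2 * y 1),
    (x 0 * y 5 - x 5 * y 0) + (P.a2 - P.b2) * (x 1 * y 4 - x 4 * y 1)
      + P.b2 * (x 2 * y 3 - x 3 * y 2) + P.a3 * (x 1 * y 3 - x 3 * y 1)
      + P.a4 * (x 1 * y 2 - x 2 * y 1),
    P.ε * (x 0 * y 6 - x 6 * y 0)
      + P.η * ((x 1 * y 6 - x 6 * y 1) - (x 2 * y 5 - x 5 * y 2) + (x 3 * y 4 - x 4 * y 3))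
      + P.ε * (P.a2 - 2 * P.b2) * (x 1 * y 5 - x 5 * y 1)
      + P.ε * P.b2 * (x 2 * y 4 - x 4 * y 2)
      + (P.ε * P.a3 - P.b3) * (x 1 * y 4 - x 4 * y 1) + P.b3 * (x 2 * y 3 - x 3 * y 2)
      + P.ε * P.a4 * (x 1 * y 3 - x 3 * y 1) + P.a5 * (x 1 * y 2 - x 2 * y 1)]

/-- The structure constants of the algebras of the table. -/
noncomputable def TableName.params : TableName → Params
  | .m0 => ⟨1, 0, 0, 0, 0, 0, 0, 0⟩
  | .m1 => ⟨1, 1, 0, 0, 0, 0, 0, 0⟩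
  | .m2 => ⟨1, 0, 1, 0, 0, 0, 0, 0⟩
  | .g α => ⟨1, 0, 2 + α, 1, 0, 0, 0, 0⟩
  | .a t => ⟨1, 0, 0, 0, t + 1, 1, 0, 0⟩
  | .c10 => ⟨1, 0, 0, 0, 1, 0, 0, 0⟩
  | .d1 => ⟨1, 0, 0, 0, 0, 0, 1, 0⟩
  | .h1 => ⟨1, 0, 0, 0, 0, 0, 0, 1⟩
  | .b => ⟨0, -1, -1 / 2, 1, 0, 0, 0, 0⟩
  | .k1 => ⟨0, -1, 0, 0, 1, 0, 0, 0⟩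
  | .s1 => ⟨0, -1, 0, 0, 0, 0, 1, 0⟩

theorem mu_relations (s : TableName) (x y : Fin 8 → ℝ) :
    mu (relations s) x y = s.params.bracket x y := by
  have p1 : pos 1 = 0 := rfl
  have p2 : pos 2 = 1 := rfl
  have p3 : pos 3 = 2 := rfl
  have p4 : pos 4 = 3 := rfl
  have p5 : pos 5 = 4 := rfl
  have p6 : pos 6 = 5 := rfl
  have p7 : pos 7 = 6 := rfl
  have p8 : pos 8 = 7 := rfl
  ext m
  cases s <;> fin_cases m <;>
    simp [relations, chain7, chain6, mu_cons, mu_nil, p1, p2, p3, p4, p5, p6, p7, p8,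
      TableName.params, Params.bracket] <;> ring

namespace TableAlgebra

/-- The coordinates of the elements of an algebra of the table. -/
noncomputable def coords (s : TableName) : TableAlgebra s ≃ₗ[ℝ] (Fin 8 → ℝ) :=
  LinearEquiv.refl ℝ (Fin 8 → ℝ)

theorem coords_lie (s : TableName) (x y : TableAlgebra s) :
    coords s ⁅x, y⁆ = s.params.bracket (coords s x) (coords s y) :=
  mu_relations s (coords s x) (coords s y)

/-- The standard basis of an algebra of the table, indexed from `0`. -/
noncomputable def stdBasis (s : TableName) : Module.Basis (Fin 8) ℝ (TableAlgebra s) :=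
  Module.Basis.ofEquivFun (coords s)

theorem coords_stdBasis (s : TableName) (i : Fin 8) : coords s (stdBasis s i) = Pi.single i 1 := by
  simp [stdBasis]

end TableAlgebra

/-- A spanning family of eight vectors of a Lie algebra that satisfies enough of the relations of
the bracket with structure constants `P` to determine the Lie algebra. -/
structure Adapted {L : Type*} [LieRing L] [LieAlgebra ℝ L] (f : Fin 8 → L) (P : Params) : Prop where
  span : ⊤ ≤ Submodule.span ℝ (Set.range f)
  l01 : ⁅f 0, f 1⁆ = f 2
  l02 : ⁅f 0, f 2⁆ = f 3
  l03 : ⁅f 0, f 3⁆ = f 4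
  l04 : ⁅f 0, f 4⁆ = f 5
  l05 : ⁅f 0, f 5⁆ = f 6
  l06 : ⁅f 0, f 6⁆ = P.ε • f 7
  l07 : ⁅f 0, f 7⁆ = 0
  l12 : ⁅f 1, f 2⁆ = P.a2 • f 4 + P.a3 • f 5 + P.a4 • f 6 + P.a5 • f 7
  l17 : ⁅f 1, f 7⁆ = 0
  l23 : ⁅f 2, f 3⁆ = P.b2 • f 6 + P.b3 • f 7
  l34 : ⁅f 3, f 4⁆ = P.η • f 7
  l45 : ⁅f 4, f 5⁆ = 0
  l56 : ⁅f 5, f 6⁆ = 0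

namespace Adapted

variable {L : Type*} [LieRing L] [LieAlgebra ℝ L] {f : Fin 8 → L} {P : Params}

/-- From here to `l67` each missing bracket comes from applying the derivation `ad (f 0)`, which
shifts the chain, to a bracket already known. -/
theorem l13 (h : Adapted f P) : ⁅f 1, f 3⁆ = P.a2 • f 5 + P.a3 • f 6 + (P.ε * P.a4) • f 7 := by
  have := leibniz_lie (f 0) (f 1) (f 2)
  rw [h.l01, lie_self, h.l02, h.l12] at this
  simp only [lie_add, lie_smul, h.l04, h.l05, h.l06, h.l07, zero_add] at this
  rw [← this]; module

theorem l14 (h : Adapted f P) :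
    ⁅f 1, f 4⁆ = (P.a2 - P.b2) • f 6 + (P.ε * P.a3 - P.b3) • f 7 := by
  have := leibniz_lie (f 0) (f 1) (f 3)
  rw [h.l01, h.l03, h.l13, h.l23] at this
  simp only [lie_add, lie_smul, h.l05, h.l06, h.l07] at this
  rw [← sub_eq_iff_eq_add'] at this
  rw [← this]; module

theorem l24 (h : Adapted f P) : ⁅f 2, f 4⁆ = (P.ε * P.b2) • f 7 := by
  have := leibniz_lie (f 0) (f 2) (f 3)
  rw [h.l02, h.l03, lie_self, h.l23] at this
  simp only [lie_add, lie_smul, h.l06, h.l07, zero_add] at this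
  rw [← this]; module

theorem l15 (h : Adapted f P) : ⁅f 1, f 5⁆ = (P.ε * (P.a2 - 2 * P.b2)) • f 7 := by
  have := leibniz_lie (f 0) (f 1) (f 4)
  rw [h.l01, h.l04, h.l14, h.l24] at this
  simp only [lie_add, lie_smul, h.l06, h.l07] at this
  rw [← sub_eq_iff_eq_add'] at this
  rw [← this]; module

theorem l25 (h : Adapted f P) : ⁅f 2, f 5⁆ = (-P.η) • f 7 := by
  have := leibniz_lie (f 0) (f 2) (f 4)
  rw [h.l02, h.l04, h.l24, h.l34] at this
  simp only [lie_smul, h.l07] at this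
  rw [← sub_eq_iff_eq_add'] at this
  rw [← this]; module

theorem l16 (h : Adapted f P) : ⁅f 1, f 6⁆ = P.η • f 7 := by
  have := leibniz_lie (f 0) (f 1) (f 5)
  rw [h.l01, h.l05, h.l15, h.l25] at this
  simp only [lie_smul, h.l07] at this
  rw [← sub_eq_iff_eq_add'] at this
  rw [← this]; module

theorem l35 (h : Adapted f P) : ⁅f 3, f 5⁆ = 0 := by
  have := leibniz_lie (f 0) (f 3) (f 4)
  rw [h.l03, h.l04, h.l34, lie_self] at this
  simp only [lie_smul, h.l07] at this
  simpa using this.symm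

theorem l26 (h : Adapted f P) : ⁅f 2, f 6⁆ = 0 := by
  have := leibniz_lie (f 0) (f 2) (f 5)
  rw [h.l02, h.l05, h.l25, h.l35] at this
  simp only [lie_smul, h.l07] at this
  simpa using this.symm

theorem l36 (h : Adapted f P) : ⁅f 3, f 6⁆ = 0 := by
  have := leibniz_lie (f 0) (f 3) (f 5)
  rw [h.l03, h.l05, h.l35, h.l45] at this
  simpa using this.symm

theorem l46 (h : Adapted f P) : ⁅f 4, f 6⁆ = 0 := by
  have := leibniz_lie (f 0) (f 4) (f 5)
  rw [h.l04, h.l05, h.l45, lie_self] at this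
  simpa using this.symm

theorem l27 (h : Adapted f P) : ⁅f 2, f 7⁆ = 0 := by
  have := leibniz_lie (f 0) (f 1) (f 7)
  rw [h.l01, h.l07, h.l17] at this
  simpa using this.symm

theorem l37 (h : Adapted f P) : ⁅f 3, f 7⁆ = 0 := by
  have := leibniz_lie (f 0) (f 2) (f 7)
  rw [h.l02, h.l07, h.l27] at this
  simpa using this.symm

theorem l47 (h : Adapted f P) : ⁅f 4, f 7⁆ = 0 := by
  have := leibniz_lie (f 0) (f 3) (f 7)
  rw [h.l03, h.l07, h.l37] at this
  simpa using this.symm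

theorem l57 (h : Adapted f P) : ⁅f 5, f 7⁆ = 0 := by
  have := leibniz_lie (f 0) (f 4) (f 7)
  rw [h.l04, h.l07, h.l47] at this
  simpa using this.symm

theorem l67 (h : Adapted f P) : ⁅f 6, f 7⁆ = 0 := by
  have := leibniz_lie (f 0) (f 5) (f 7)
  rw [h.l05, h.l07, h.l57] at this
  simpa using this.symm

/-- This is the Jacobi identity of `f 1`, `f 2`, `f 3`, which does not involve `f 0`. It ties `b2`
to `a2` when `η ≠ 0`, which is why `b` is a single algebra and not a curve. -/
theorem jacobi_relation (h : Adapted f P) (h7 : f 7 ≠ 0) (hε : P.ε = 0) :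
    P.η * (P.b2 + 2 * P.a2) = 0 := by
  have := leibniz_lie (f 1) (f 2) (f 3)
  have h54 : ⁅f 4, f 3⁆ = -(P.η • f 7) := by rw [← lie_skew, h.l34]
  have h53 : ⁅f 5, f 3⁆ = 0 := by rw [← lie_skew, h.l35, neg_zero]
  have h63 : ⁅f 6, f 3⁆ = 0 := by rw [← lie_skew, h.l36, neg_zero]
  have h73 : ⁅f 7, f 3⁆ = 0 := by rw [← lie_skew, h.l37, neg_zero]
  rw [h.l23, h.l12, h.l13] at this
  simp only [lie_add, add_lie, smul_lie, lie_smul, h.l16, h.l17, h54, h53, h63, h73, h.l25, h.l26,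
    h.l27, hε] at this
  have h0 : (P.η * (P.b2 + 2 * P.a2)) • f 7 = 0 := by
    rw [← sub_eq_zero] at this
    rw [← this]; module
  exact (smul_eq_zero.1 h0).resolve_right h7

theorem lie_sum (h : Adapted f P) (x y : Fin 8 → ℝ) :
    ⁅∑ i, x i • f i, ∑ i, y i • f i⁆ = ∑ i, P.bracket x y i • f i := by
  have skew (i j : Fin 8) (v : L) (hv : ⁅f i, f j⁆ = v) : ⁅f j, f i⁆ = -v := by
    rw [← lie_skew, hv]
  simp only [Fin.sum_univ_eight, lie_add, add_lie, smul_lie, lie_smul, lie_self,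
    h.l01, h.l02, h.l03, h.l04, h.l05, h.l06, h.l07, h.l12, h.l13, h.l14, h.l15, h.l16, h.l17,
    h.l23, h.l24, h.l25, h.l26, h.l27, h.l34, h.l35, h.l36, h.l37, h.l45, h.l46, h.l47, h.l56,
    h.l57, h.l67,
    skew _ _ _ h.l01, skew _ _ _ h.l02, skew _ _ _ h.l03, skew _ _ _ h.l04, skew _ _ _ h.l05,
    skew _ _ _ h.l06, skew _ _ _ h.l07, skew _ _ _ h.l12, skew _ _ _ h.l13, skew _ _ _ h.l14,
    skew _ _ _ h.l15, skew _ _ _ h.l16, skew _ _ _ h.l17, skew _ _ _ h.l23, skew _ _ _ h.l24,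
    skew _ _ _ h.l25, skew _ _ _ h.l26, skew _ _ _ h.l27, skew _ _ _ h.l34, skew _ _ _ h.l35,
    skew _ _ _ h.l36, skew _ _ _ h.l37, skew _ _ _ h.l45, skew _ _ _ h.l46, skew _ _ _ h.l47,
    skew _ _ _ h.l56, skew _ _ _ h.l57, skew _ _ _ h.l67, Params.bracket]
  simp only [Matrix.cons_val]
  module

/-- An adapted family of a Lie algebra of dimension `8` is a basis. -/
noncomputable def basis (h : Adapted f P) (hL : Module.finrank ℝ L = 8) :
    Module.Basis (Fin 8) ℝ L :=
  basisOfTopLeSpanOfCardEqFinrank f h.span (by simp [hL])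

/-- The isomorphism with an algebra of the table that an adapted family defines. -/
noncomputable def equivTable (h : Adapted f P) (hL : Module.finrank ℝ L = 8) (s : TableName)
    (hs : P = s.params) : L ≃ₗ⁅ℝ⁆ TableAlgebra s :=
  LieEquiv.symm
    { (TableAlgebra.coords s).trans (h.basis hL).equivFun.symm with
      map_lie' := by
        intro x y
        have key (z : Fin 8 → ℝ) : (h.basis hL).equivFun.symm z = ∑ i, z i • f i := by
          simp [Module.Basis.equivFun_symm_apply, basis]
        change (h.basis hL).equivFun.symm (TableAlgebra.coords s ⁅x, y⁆) =
          ⁅(h.basis hL).equivFun.symm (TableAlgebra.coords s x),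
            (h.basis hL).equivFun.symm (TableAlgebra.coords s y)⁆
        rw [TableAlgebra.coords_lie, key, key, key, ← hs, h.lie_sum] }

theorem map {L' : Type*} [LieRing L'] [LieAlgebra ℝ L'] (h : Adapted f P) (φ : L ≃ₗ⁅ℝ⁆ L') :
    Adapted (fun i => φ (f i)) P where
  span := by
    have : Set.range (fun i => φ (f i)) =
        Set.image (φ.toLinearEquiv : L →ₗ[ℝ] L') (Set.range f) := by
      rw [← Set.range_comp]; rfl
    rw [this, Submodule.span_image, top_le_iff.1 h.span, Submodule.map_top,
      LinearEquiv.range]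
  l01 := by rw [← LieEquiv.map_lie, h.l01]
  l02 := by rw [← LieEquiv.map_lie, h.l02]
  l03 := by rw [← LieEquiv.map_lie, h.l03]
  l04 := by rw [← LieEquiv.map_lie, h.l04]
  l05 := by rw [← LieEquiv.map_lie, h.l05]
  l06 := by rw [← LieEquiv.map_lie, h.l06, map_smul]
  l07 := by rw [← LieEquiv.map_lie, h.l07, map_zero]
  l12 := by rw [← LieEquiv.map_lie, h.l12]; simp only [map_add, map_smul]
  l17 := by rw [← LieEquiv.map_lie, h.l17, map_zero]
  l23 := by rw [← LieEquiv.map_lie, h.l23]; simp only [map_add, map_smul]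
  l34 := by rw [← LieEquiv.map_lie, h.l34, map_smul]
  l45 := by rw [← LieEquiv.map_lie, h.l45, map_zero]
  l56 := by rw [← LieEquiv.map_lie, h.l56, map_zero]

end Adapted

theorem TableAlgebra.adapted (s : TableName) : Adapted (stdBasis s) s.params := by
  refine ⟨(stdBasis s).span_eq.ge, ?_, ?_, ?_, ?_, ?_, ?_, ?_, ?_, ?_, ?_, ?_, ?_, ?_⟩ <;>
  · apply (coords s).injective
    simp only [coords_lie, map_add, map_smul, map_zero, coords_stdBasis]
    ext m
    fin_cases m <;> simp [Params.bracket]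

end FiliformGraded

/-! ### Invariants that separate the listed algebras -/

namespace FiliformGraded

/-- Two sets of structure constants whose brackets are isomorphic have proportional leading
terms. -/
theorem Adapted.compare {s : TableName} {P : Params} {f : Fin 8 → TableAlgebra s}
    (h : Adapted f P) (h7 : f 7 ≠ 0) (hP : P.ε ≠ 0 ∨ P.η ≠ 0) :
    ∃ x y : ℝ, x ≠ 0 ∧ y ≠ 0 ∧ (P.η = 0 ↔ s.params.η = 0) ∧
      s.params.a2 * y = P.a2 * x ^ 2 ∧ s.params.b2 * y = P.b2 * x ^ 2 ∧
      (P.a2 = 0 → P.b2 = 0 →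
        s.params.a3 * y = P.a3 * x ^ 3 ∧
        (P.a3 = 0 → s.params.a4 * y = P.a4 * x ^ 4) ∧
        (P.ε = 1 → s.params.ε = 1 → P.η = 0 →
          s.params.b3 * y = P.b3 * x ^ 3 ∧
          (P.a3 = 0 → P.b3 = 0 → P.a4 = 0 → s.params.a5 * y = P.a5 * x ^ 5))) := by
  set Q := s.params with hQ
  have rel {u v w : TableAlgebra s} (e : ⁅u, v⁆ = w) (m : Fin 8) :
      Q.bracket (TableAlgebra.coords s u) (TableAlgebra.coords s v) m =
        TableAlgebra.coords s w m := by
    rw [← e, TableAlgebra.coords_lie]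
  have r01 := rel h.l01
  have r02 := rel h.l02
  have r03 := rel h.l03
  have r04 := rel h.l04
  have r05 := rel h.l05
  have r06 := rel h.l06
  have r16 := rel h.l16
  have r12 := rel h.l12
  have r23 := rel h.l23
  have hc7 : TableAlgebra.coords s (f 7) ≠ 0 := by simpa using h7
  simp only [map_add, map_smul, Pi.add_apply, Pi.smul_apply, smul_eq_mul]
    at r01 r02 r03 r04 r05 r06 r16 r12 r23
  generalize TableAlgebra.coords s (f 0) = x at *
  generalize TableAlgebra.coords s (f 1) = y at *
  generalize TableAlgebra.coords s (f 2) = c2 at *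
  generalize TableAlgebra.coords s (f 3) = c3 at *
  generalize TableAlgebra.coords s (f 4) = c4 at *
  generalize TableAlgebra.coords s (f 5) = c5 at *
  generalize TableAlgebra.coords s (f 6) = c6 at *
  generalize TableAlgebra.coords s (f 7) = c7 at *
  have z2 : c2 0 = 0 ∧ c2 1 = 0 := by
    simp [← r01, Params.bracket]
  have e2 : c2 2 = x 0 * y 1 - x 1 * y 0 := by
    simp [← r01, Params.bracket]
  have z3 : c3 0 = 0 ∧ c3 1 = 0 ∧ c3 2 = 0 := by
    simp [← r02, Params.bracket, z2]
  have e3 : c3 3 = x 0 * c2 2 := by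
    simp [← r02, Params.bracket, z2]
  have z4 : c4 0 = 0 ∧ c4 1 = 0 ∧ c4 2 = 0 ∧ c4 3 = 0 := by
    simp [← r03, Params.bracket, z3]
  have e4 : c4 4 = x 0 * c3 3 := by
    simp [← r03, Params.bracket, z3]
  have z5 : c5 0 = 0 ∧ c5 1 = 0 ∧ c5 2 = 0 ∧ c5 3 = 0 ∧ c5 4 = 0 := by
    simp [← r04, Params.bracket, z4]
  have e5 : c5 5 = x 0 * c4 4 := by
    simp [← r04, Params.bracket, z4]
  have z6 : c6 0 = 0 ∧ c6 1 = 0 ∧ c6 2 = 0 ∧ c6 3 = 0 ∧ c6 4 = 0 ∧ c6 5 = 0 := by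
    simp [← r05, Params.bracket, z5]
  have e6 : c6 6 = x 0 * c5 5 := by
    simp [← r05, Params.bracket, z5]
  have z7ε : P.ε * c7 7 = (Q.ε * x 0 + Q.η * x 1) * c6 6 := by
    simp [← r06, Params.bracket, z6]; ring
  have z7η : P.η * c7 7 = Q.η * y 1 * c6 6 + Q.ε * y 0 * c6 6 := by
    simp [← r16, Params.bracket, z6]; ring
  -- If `c2 2` vanished, so would `c6 6`, and `c6` would commute with both `x` and `y`. But one of
  -- these brackets is a nonzero multiple of the nonzero vector `c7`.
  have hD : c2 2 ≠ 0 := by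
    intro hD
    have h66 : c6 6 = 0 := by simp [e6, e5, e4, e3, hD]
    have e06 (m : Fin 8) : P.ε * c7 m = 0 := by
      rw [← r06]; fin_cases m <;> simp [Params.bracket, z6, h66]
    have e16 (m : Fin 8) : P.η * c7 m = 0 := by
      rw [← r16]; fin_cases m <;> simp [Params.bracket, z6, h66]
    refine hc7 (funext fun m => ?_)
    rcases hP with hP | hP
    · exact (mul_eq_zero.1 (e06 m)).resolve_left hP
    · exact (mul_eq_zero.1 (e16 m)).resolve_left hP
  have z7 : c7 0 = 0 ∧ c7 1 = 0 ∧ c7 2 = 0 ∧ c7 3 = 0 ∧ c7 4 = 0 ∧ c7 5 = 0 ∧ c7 6 = 0 := by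
    rcases hP with hP | hP
    · have key (m : Fin 8) (hm : Q.bracket x c6 m = 0) : c7 m = 0 :=
        (mul_eq_zero.1 ((r06 m).symm.trans hm)).resolve_left hP
      refine ⟨key _ ?_, key _ ?_, key _ ?_, key _ ?_, key _ ?_, key _ ?_, key _ ?_⟩ <;>
        simp [Params.bracket, z6]
    · have key (m : Fin 8) (hm : Q.bracket y c6 m = 0) : c7 m = 0 :=
        (mul_eq_zero.1 ((r16 m).symm.trans hm)).resolve_left hP
      refine ⟨key _ ?_, key _ ?_, key _ ?_, key _ ?_, key _ ?_, key _ ?_, key _ ?_⟩ <;>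
        simp [Params.bracket, z6]
  have h77 : c7 7 ≠ 0 := by
    intro h0
    refine hc7 (funext fun m => ?_)
    fin_cases m <;> simp [z7, h0]
  -- Coordinate 3 of `⁅f 1, f 2⁆` is `y 0 * c2 2`, whereas its expansion starts at coordinate 4.
  have hy0 : y 0 = 0 := by
    have := r12 3
    simpa [Params.bracket, z2, z4, z5, z6, z7, hD] using this
  have hDxy : c2 2 = x 0 * y 1 := by rw [e2, hy0, mul_zero, sub_zero]
  have hx : x 0 ≠ 0 := fun h0 => hD (by rw [hDxy, h0, zero_mul])
  have hy : y 1 ≠ 0 := fun h0 => hD (by rw [hDxy, h0, mul_zero])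
  have h33 : c3 3 = x 0 ^ 2 * y 1 := by rw [e3, hDxy]; ring
  have h44 : c4 4 = x 0 ^ 3 * y 1 := by rw [e4, h33]; ring
  have h55 : c5 5 = x 0 ^ 4 * y 1 := by rw [e5, h44]; ring
  have h66 : c6 6 = x 0 ^ 5 * y 1 := by rw [e6, h55]; ring
  have h66' : c6 6 ≠ 0 := by rw [h66]; positivity
  -- The leading coordinate of `f k` is `x 0 ^ (k - 1) * y 1` for `2 ≤ k ≤ 6`. Each relation is read
  -- at its leading coordinate and the common monomial is cancelled.
  have ha2 : Q.a2 * y 1 = P.a2 * x 0 ^ 2 := by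
    have := r12 4
    simp [Params.bracket, z2, h44, z5, z6, z7, hy0, hDxy] at this
    apply mul_right_cancel₀ (mul_ne_zero hx hy)
    linear_combination this
  have hb2 : Q.b2 * y 1 = P.b2 * x 0 ^ 2 := by
    have := r23 6
    simp [Params.bracket, z2, z3, h33, h66, z7, hDxy] at this
    apply mul_right_cancel₀ (mul_ne_zero (pow_ne_zero 3 hx) hy)
    linear_combination this
  rw [hy0, mul_zero, zero_mul, add_zero] at z7η
  refine ⟨x 0, y 1, hx, hy, ?_, ha2, hb2, fun hPa2 hPb2 => ?_⟩
  · constructor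
    · intro h0
      simpa [h0, hy, h66'] using z7η
    · intro h0
      simpa [h0, h77] using z7η
  have hQa2 : Q.a2 = 0 := by simpa [hPa2, hy] using ha2
  have hQb2 : Q.b2 = 0 := by simpa [hPb2, hy] using hb2
  have ha3 : Q.a3 * y 1 = P.a3 * x 0 ^ 3 := by
    have := r12 5
    simp [Params.bracket, z2, h55, z6, z7, hy0, hDxy, hQa2, hPa2] at this
    apply mul_right_cancel₀ (mul_ne_zero hx hy)
    linear_combination this
  refine ⟨ha3, fun hPa3 => ?_, fun hPε hQε hPη => ⟨?_, fun hPa3 hPb3 hPa4 => ?_⟩⟩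
  · have hQa3 : Q.a3 = 0 := by simpa [hPa3, hy] using ha3
    have := r12 6
    simp [Params.bracket, z2, h66, z7, hy0, hDxy, hQa2, hPa2, hQb2, hPa3, hQa3] at this
    apply mul_right_cancel₀ (mul_ne_zero hx hy)
    linear_combination this
  all_goals
    have hQη : Q.η = 0 := by simpa [hPη, hy, h66'] using z7η
    -- With `ε = 1` on both sides and `η = 0`, the pattern of leading coordinates extends to the
    -- last vector.
    have h77 : c7 7 = x 0 ^ 6 * y 1 := by
      rw [hPε, hQε, hQη, h66] at z7ε
      linear_combination z7ε
    have hb3 : Q.b3 * y 1 = P.b3 * x 0 ^ 3 := by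
      have := r23 7
      simp [Params.bracket, z2, z3, h77, hDxy, h33, hPb2, hQb2, hQη] at this
      apply mul_right_cancel₀ (mul_ne_zero (pow_ne_zero 3 hx) hy)
      linear_combination this
  · exact hb3
  · have hQa3 : Q.a3 = 0 := by simpa [hPa3, hy] using ha3
    have hQb3 : Q.b3 = 0 := by simpa [hPb3, hy] using hb3
    have hQa4 : Q.a4 = 0 := by
      have := r12 6
      simp [Params.bracket, z2, z7, hy0, hDxy, hQa2, hPa2, hQb2, hPa3, hQa3, hPa4, hx, hy] at this
      exact this
    have := r12 7
    simp [Params.bracket, z2, h77, hy0, hDxy, hQa2, hPa2, hQb2, hPa3, hQa3, hQb3, hPa4, hQa4, hQη]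
      at this
    apply mul_right_cancel₀ (mul_ne_zero hx hy)
    linear_combination this

theorem TableName.params_ε_or_η (s : TableName) : s.params.ε ≠ 0 ∨ s.params.η ≠ 0 := by
  cases s <;> simp [TableName.params]

/-- The algebras of the table are pairwise non-isomorphic. -/
theorem TableName.eq_of_equiv {s s' : TableName} (φ : TableAlgebra s ≃ₗ⁅ℝ⁆ TableAlgebra s') :
    s = s' := by
  obtain ⟨x, y, hx, hy, hη, ha2, hb2, H⟩ := ((TableAlgebra.adapted s).map φ).compare
    (by simpa using (TableAlgebra.stdBasis s).ne_zero 7) s.params_ε_or_η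
  have hx' (n : ℕ) : 0 ≠ x ^ n := (pow_ne_zero n hx).symm
  -- Vanishing patterns settle all pairs except two members of one curve. There the normalization
  -- `b2 = 1` or `b3 = 1` gives `y = x ^ 2` or `y = x ^ 3`, and `a2` or `a3` then recovers the
  -- parameter.
  cases s <;> cases s' <;> simp [TableName.params, hx, hy, hx'] at hη ha2 hb2 H ⊢
  · rw [hb2] at ha2
    linarith [mul_right_cancel₀ (pow_ne_zero 2 hx) ha2]
  · rw [H.2] at H
    linarith [mul_right_cancel₀ (pow_ne_zero 3 hx) H.1]

end FiliformGraded

/-! ### Filiformity and gradations of the listed algebras -/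

namespace FiliformGraded

open LieModule TableAlgebra

/-- The elements of an algebra of the table whose first `k` coordinates vanish. -/
def TableAlgebra.tail (s : TableName) (k : ℕ) : Submodule ℝ (TableAlgebra s) where
  carrier := {x | ∀ i : Fin 8, (i : ℕ) < k → coords s x i = 0}
  zero_mem' := by intro i _; simp
  add_mem' := by intro x y hx hy i hi; simp [hx i hi, hy i hi]
  smul_mem' := by intro c x hx i hi; simp [hx i hi]

/-- Coordinate `i` of a bracket involves the second argument only through its earlier coordinates.
-/
theorem Params.bracket_apply_eq_zero (P : Params) (x : Fin 8 → ℝ) {y : Fin 8 → ℝ} {i : Fin 8}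
    (h : ∀ j < i, y j = 0) : P.bracket x y i = 0 := by
  fin_cases i <;> simp [Fin.forall_fin_succ] at h <;> simp [Params.bracket, h]

theorem TableAlgebra.lie_mem_tail (s : TableName) {k : ℕ} (x : TableAlgebra s)
    {y : TableAlgebra s} (hy : y ∈ tail s k) : ⁅x, y⁆ ∈ tail s (k + 1) := by
  intro i hi
  rw [coords_lie]
  exact Params.bracket_apply_eq_zero _ _ fun j hj => hy j (by omega)

/-- The first commutator loses two coordinates, those of the generators, and each further one loses
one more. -/
theorem TableAlgebra.lowerCentralSeries_le (s : TableName) (k : ℕ) :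
    (lowerCentralSeries ℝ (TableAlgebra s) (TableAlgebra s) (k + 1)).toSubmodule ≤
      tail s (k + 2) := by
  induction k with
  | zero =>
    rw [lowerCentralSeries_succ, LieSubmodule.lieIdeal_oper_eq_linear_span', Submodule.span_le]
    rintro _ ⟨x, -, y, -, rfl⟩ i hi
    rw [coords_lie]
    have : i = 0 ∨ i = 1 := by omega
    rcases this with rfl | rfl <;> simp [Params.bracket]
  | succ k ih =>
    rw [lowerCentralSeries_succ, LieSubmodule.lieIdeal_oper_eq_linear_span', Submodule.span_le]
    rintro _ ⟨x, -, y, hy, rfl⟩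
    exact lie_mem_tail s x (ih hy)

/-- The chain reaches the last vector through `⁅f 0, f 6⁆` if `ε ≠ 0` and through `⁅f 1, f 6⁆` if `η
≠ 0`. Hence the step is not less than seven. -/
theorem TableAlgebra.stdBasis_mem (s : TableName) :
    stdBasis s 7 ∈ lowerCentralSeries ℝ (TableAlgebra s) (TableAlgebra s) 6 := by
  have step {k : ℕ} {y : TableAlgebra s} (x : TableAlgebra s)
      (hy : y ∈ lowerCentralSeries ℝ (TableAlgebra s) (TableAlgebra s) k) :
      ⁅x, y⁆ ∈ lowerCentralSeries ℝ (TableAlgebra s) (TableAlgebra s) (k + 1) := by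
    rw [lowerCentralSeries_succ]
    exact LieSubmodule.lie_mem_lie (LieSubmodule.mem_top x) hy
  have h := adapted s
  have h6 : stdBasis s 6 ∈ lowerCentralSeries ℝ (TableAlgebra s) (TableAlgebra s) 5 := by
    rw [← h.l05, ← h.l04, ← h.l03, ← h.l02, ← h.l01]
    exact step _ (step _ (step _ (step _ (step _ (LieSubmodule.mem_top _)))))
  rcases s.params_ε_or_η with hs | hs
  · rw [← inv_smul_smul₀ hs (stdBasis s 7), ← h.l06]
    exact Submodule.smul_mem _ _ (step _ h6)
  · rw [← inv_smul_smul₀ hs (stdBasis s 7), ← h.l16]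
    exact Submodule.smul_mem _ _ (step _ h6)

theorem TableAlgebra.finrank_eq (s : TableName) : Module.finrank ℝ (TableAlgebra s) = 8 := by
  simp [Module.finrank_eq_card_basis (stdBasis s)]

theorem TableAlgebra.isFiliform (s : TableName) : IsFiliform (TableAlgebra s) := by
  have h7 : lowerCentralSeries ℝ (TableAlgebra s) (TableAlgebra s) 7 = ⊥ := by
    rw [← LieSubmodule.toSubmodule_eq_bot, eq_bot_iff]
    intro x hx
    have := lowerCentralSeries_le s 6 hx
    exact (coords s).map_eq_zero_iff.1 (funext fun i => this i i.2)
  have hn : LieRing.IsNilpotent (TableAlgebra s) :=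
    (LieModule.isNilpotent_iff ℝ (TableAlgebra s) (TableAlgebra s)).2 ⟨7, h7⟩
  refine ⟨Module.Finite.of_basis (stdBasis s), hn, ?_⟩
  rw [finrank_eq, (nilpotencyLength_eq_succ_iff ℝ (TableAlgebra s) (TableAlgebra s) 6).2 ⟨h7, ?_⟩]
  intro h6
  have := stdBasis_mem s
  rw [h6, LieSubmodule.mem_bot] at this
  exact (stdBasis s).ne_zero 7 this

/-- The degrees of the standard basis vectors for a gradation of an algebra of the table. -/
def TableName.degree : TableName → Fin 8 → ℕ+
  | .m0 => ![1, 1, 2, 3, 4, 5, 6, 7]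
  | .m1 => ![1, 1, 2, 3, 4, 5, 6, 7]
  | .m2 => ![1, 2, 3, 4, 5, 6, 7, 8]
  | .g _ => ![1, 2, 3, 4, 5, 6, 7, 8]
  | .a _ => ![1, 3, 4, 5, 6, 7, 8, 9]
  | .c10 => ![1, 3, 4, 5, 6, 7, 8, 9]
  | .d1 => ![1, 4, 5, 6, 7, 8, 9, 10]
  | .h1 => ![1, 5, 6, 7, 8, 9, 10, 11]
  | .b => ![1, 2, 3, 4, 5, 6, 7, 9]
  | .k1 => ![1, 3, 4, 5, 6, 7, 8, 11]
  | .s1 => ![1, 4, 5, 6, 7, 8, 9, 13]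

/-- The linear map that multiplies each standard basis vector by its degree. -/
noncomputable def TableAlgebra.degreeMap (s : TableName) : Module.End ℝ (TableAlgebra s) :=
  (coords s).symm.conj (LinearMap.pi fun i => (s.degree i : ℝ) • LinearMap.proj i)

theorem TableAlgebra.coords_degreeMap (s : TableName) (x : TableAlgebra s) :
    coords s (degreeMap s x) = fun i => (s.degree i : ℝ) * coords s x i := by
  ext i
  simp [degreeMap, LinearEquiv.conj_apply]

theorem TableAlgebra.degreeMap_lie (s : TableName) (x y : TableAlgebra s) :
    degreeMap s ⁅x, y⁆ = ⁅degreeMap s x, y⁆ + ⁅x, degreeMap s y⁆ := by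
  apply (coords s).injective
  rw [map_add, coords_degreeMap, coords_lie, coords_lie, coords_lie, coords_degreeMap,
    coords_degreeMap]
  ext i
  cases s <;> fin_cases i <;> simp [Params.bracket, TableName.params, TableName.degree] <;> ring

/-- The eigenspaces of a diagonalizable derivation with positive integer eigenvalues form a
gradation. -/
theorem TableAlgebra.admitsNGradation (s : TableName) : AdmitsNGradation (TableAlgebra s) := by
  refine ⟨fun n => (degreeMap s).eigenspace (n : ℝ), ?_, ⟨fun i j x y hx hy => ?_⟩⟩
  · rw [DirectSum.isInternal_submodule_iff_iSupIndep_and_iSup_eq_top]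
    refine ⟨(degreeMap s).eigenspaces_iSupIndep.comp (f := fun n : ℕ+ => (n : ℝ)) ?_, ?_⟩
    · intro m n h
      simpa using h
    · rw [eq_top_iff, ← (stdBasis s).span_eq, Submodule.span_le]
      rintro _ ⟨i, rfl⟩
      refine Submodule.mem_iSup_of_mem (s.degree i) ?_
      rw [Module.End.mem_eigenspace_iff]
      apply (coords s).injective
      rw [coords_degreeMap, map_smul, coords_stdBasis]
      ext j
      rcases eq_or_ne j i with rfl | hj <;> simp [*]
  · rw [Module.End.mem_eigenspace_iff] at *
    rw [degreeMap_lie, hx, hy, smul_lie, lie_smul, ← add_smul]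
    push_cast
    rfl

end FiliformGraded

/-! ### The weight derivation and the lower central series -/

namespace FiliformGraded

open LieModule

variable {L : Type*} [LieRing L] [LieAlgebra ℝ L]

/-- A gradation in positive degrees defines a derivation that multiplies the homogeneous elements by
their degrees. -/
theorem AdmitsNGradation.exists_derivation (h : AdmitsNGradation L) :
    ∃ D : L →ₗ[ℝ] L, (∀ x y, D ⁅x, y⁆ = ⁅D x, y⁆ + ⁅x, D y⁆) ∧
      Submodule.span ℝ {x | ∃ r : ℝ, 0 < r ∧ D x = r • x} = ⊤ := by
  obtain ⟨𝒱, hi, hg⟩ := h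
  let E := LinearEquiv.ofBijective (DirectSum.coeLinearMap 𝒱) hi
  let D : L →ₗ[ℝ] L :=
    DirectSum.toModule ℝ ℕ+ L (fun i => ((i : ℕ) : ℝ) • (𝒱 i).subtype) ∘ₗ E.symm.toLinearMap
  have hD (i : ℕ+) (x : L) (hx : x ∈ 𝒱 i) : D x = ((i : ℕ) : ℝ) • x := by
    have : E.symm x = DirectSum.lof ℝ ℕ+ (fun i => 𝒱 i) i ⟨x, hx⟩ := by
      rw [LinearEquiv.symm_apply_eq]
      exact (DirectSum.coeLinearMap_lof 𝒱 i ⟨x, hx⟩).symm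
    simp [D, this]
  have hspan : ⨆ i, 𝒱 i = ⊤ := hi.submodule_iSup_eq_top
  refine ⟨D, fun x y => ?_, ?_⟩
  · have hx : x ∈ ⨆ i, 𝒱 i := hspan ▸ Submodule.mem_top
    have hy : y ∈ ⨆ i, 𝒱 i := hspan ▸ Submodule.mem_top
    induction hx using Submodule.iSup_induction' with
    | mem i x hx =>
      induction hy using Submodule.iSup_induction' with
      | mem j y hy =>
        rw [hD i x hx, hD j y hy, hD _ _ (hg.bracket_mem hx hy), smul_lie, lie_smul, ← add_smul]
        push_cast
        rfl
      | zero => simp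
      | add y z _ _ hy hz => simp only [lie_add, map_add, hy, hz]; abel
    | zero => simp
    | add x z _ _ hx hz => simp only [add_lie, map_add, hx, hz]; abel
  · rw [eq_top_iff, ← hspan, iSup_le_iff]
    intro i x hx
    exact Submodule.subset_span ⟨i, by exact_mod_cast i.pos, hD i x hx⟩

/-- The lower central series, as a sequence of subspaces. -/
noncomputable def lcs (L : Type*) [LieRing L] [LieAlgebra ℝ L] (k : ℕ) : Submodule ℝ L :=
  (lowerCentralSeries ℝ L L k).toSubmodule

theorem lcs_antitone : Antitone (lcs L) := fun _ _ h => antitone_lowerCentralSeries ℝ L L h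

theorem lie_mem_lcs_succ {k : ℕ} (x : L) {y : L} (hy : y ∈ lcs L k) : ⁅x, y⁆ ∈ lcs L (k + 1) := by
  rw [lcs, lowerCentralSeries_succ]
  exact LieSubmodule.lie_mem_lie (LieSubmodule.mem_top x) hy

theorem lie_mem_lcs_succ' {k : ℕ} {x : L} (hx : x ∈ lcs L k) (y : L) : ⁅x, y⁆ ∈ lcs L (k + 1) := by
  rw [← lie_skew]
  exact neg_mem (lie_mem_lcs_succ y hx)

theorem lcs_succ_le {k : ℕ} {W : Submodule ℝ L} (h : ∀ x : L, ∀ y ∈ lcs L k, ⁅x, y⁆ ∈ W) :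
    lcs L (k + 1) ≤ W := by
  rw [lcs, lowerCentralSeries_succ, LieSubmodule.lieIdeal_oper_eq_linear_span', Submodule.span_le]
  rintro _ ⟨x, -, y, hy, rfl⟩
  exact h x y hy

/-- Induction on `i` by the Jacobi identity. The extra `1` appears because `lcs L 0` is all of `L`.
-/
theorem lie_mem_lcs {i j : ℕ} {x y : L} (hx : x ∈ lcs L i) (hy : y ∈ lcs L j) :
    ⁅x, y⁆ ∈ lcs L (i + j + 1) := by
  induction i generalizing x y j with
  | zero => simpa using lie_mem_lcs_succ x hy
  | succ i ih =>
    have : lcs L (i + 1) ≤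
        (lcs L (i + 1 + j + 1)).comap ((toEnd ℝ L L : L →ₗ[ℝ] Module.End ℝ L).flip y) := by
      refine lcs_succ_le fun l c hc => ?_
      change ⁅⁅l, c⁆, y⁆ ∈ lcs L (i + 1 + j + 1)
      rw [lie_lie]
      have h1 := lie_mem_lcs_succ l (ih hc hy)
      have h2 := ih hc (lie_mem_lcs_succ l hy)
      rw [show i + 1 + j + 1 = i + j + 1 + 1 by omega]
      exact sub_mem h1 (by rwa [show i + j + 1 + 1 = i + (j + 1) + 1 by omega])
    exact this hx

theorem map_mem_lcs {D : L →ₗ[ℝ] L} (hD : ∀ x y, D ⁅x, y⁆ = ⁅D x, y⁆ + ⁅x, D y⁆) (k : ℕ) {x : L}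
    (hx : x ∈ lcs L k) : D x ∈ lcs L k := by
  induction k generalizing x with
  | zero => trivial
  | succ k ih =>
    have : lcs L (k + 1) ≤ (lcs L (k + 1)).comap D := by
      refine lcs_succ_le fun l c hc => ?_
      rw [Submodule.mem_comap, hD]
      exact add_mem (lie_mem_lcs_succ _ hc) (lie_mem_lcs_succ _ (ih hc))
    exact this hx

/-- A Lie algebra is not generated by one element modulo the commutator ideal. -/
theorem lcs_one_le_two_of_span {x : L} (h : Submodule.span ℝ {x} ⊔ lcs L 1 = ⊤) :
    lcs L 1 ≤ lcs L 2 := by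
  refine lcs_succ_le fun u v _ => ?_
  have hu : u ∈ Submodule.span ℝ {x} ⊔ lcs L 1 := h ▸ Submodule.mem_top
  have hv : v ∈ Submodule.span ℝ {x} ⊔ lcs L 1 := h ▸ Submodule.mem_top
  obtain ⟨u', hu', c, hc, rfl⟩ := Submodule.mem_sup.1 hu
  obtain ⟨v', hv', d, hd, rfl⟩ := Submodule.mem_sup.1 hv
  obtain ⟨a, rfl⟩ := Submodule.mem_span_singleton.1 hu'
  obtain ⟨b, rfl⟩ := Submodule.mem_span_singleton.1 hv'
  simp only [add_lie, lie_add, smul_lie, lie_smul, lie_self, smul_zero, zero_add]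
  exact add_mem (Submodule.smul_mem _ _ (lie_mem_lcs_succ' hc _))
    (add_mem (Submodule.smul_mem _ _ (lie_mem_lcs_succ _ hd)) (lie_mem_lcs_succ _ hd))

end FiliformGraded

/-! ### Two generators and one-dimensional quotients -/

namespace FiliformGraded

open LieModule Module

variable {L : Type*} [LieRing L] [LieAlgebra ℝ L]

/-- Once two consecutive terms agree the series is constant, so it could not drop from `lcs L 6` to
zero. -/
theorem not_lcs_le_succ (h7 : lcs L 7 = ⊥) (h6 : lcs L 6 ≠ ⊥) {k : ℕ} (hk : k < 7) :
    ¬ lcs L k ≤ lcs L (k + 1) := by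
  intro h
  have step (j : ℕ) (hj : lcs L j ≤ lcs L (j + 1)) : lcs L (j + 1) ≤ lcs L (j + 2) :=
    lcs_succ_le fun l c hc => lie_mem_lcs_succ l (hj hc)
  have all (j : ℕ) : lcs L (k + j) ≤ lcs L (k + j + 1) := by
    induction j with
    | zero => exact h
    | succ j ih => exact step _ ih
  obtain ⟨j, hj⟩ : ∃ j, k + j = 6 := ⟨6 - k, by omega⟩
  have := all j
  rw [hj, h7] at this
  exact h6 (le_bot_iff.1 this)

theorem IsFiliform.lcs_eq (hL : finrank ℝ L = 8) (h : IsFiliform L) :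
    lcs L 7 = ⊥ ∧ lcs L 6 ≠ ⊥ := by
  obtain ⟨_, hn, hl⟩ := h
  have := (nilpotencyLength_eq_succ_iff ℝ L L 6).1 (by omega)
  simpa [lcs] using this

theorem finrank_lcs_strictAnti [FiniteDimensional ℝ L] (h7 : lcs L 7 = ⊥)
    (h6 : lcs L 6 ≠ ⊥) {k : ℕ} (hk : k < 7) :
    finrank ℝ (lcs L (k + 1)) < finrank ℝ (lcs L k) :=
  Submodule.finrank_lt_finrank_of_lt
    (lt_of_le_not_ge (lcs_antitone k.le_succ) (not_lcs_le_succ h7 h6 hk))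

theorem sup_span_lcs_one_ne_top (h7 : lcs L 7 = ⊥) (h6 : lcs L 6 ≠ ⊥) (x : L) :
    Submodule.span ℝ {x} ⊔ lcs L 1 ≠ ⊤ := fun h =>
  not_lcs_le_succ h7 h6 (k := 1) (by norm_num) (lcs_one_le_two_of_span h)

theorem exists_mem_not_mem_of_span_eq_top {S : Set L} (hS : Submodule.span ℝ S = ⊤)
    {W : Submodule ℝ L} (hW : W ≠ ⊤) : ∃ x ∈ S, x ∉ W := by
  by_contra! h
  exact hW (top_le_iff.1 (hS ▸ Submodule.span_le.2 h))

theorem lt_span_singleton_sup {x : L} {W : Submodule ℝ L} (hx : x ∉ W) :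
    W < Submodule.span ℝ {x} ⊔ W :=
  lt_of_le_not_ge le_sup_right fun h =>
    hx (h (Submodule.mem_sup_left (Submodule.mem_span_singleton_self x)))

/-- The Lie algebra is spanned by two elements modulo the commutator ideal. -/
def Generates (x y : L) : Prop := ∀ l : L, ∃ a b : ℝ, ∃ d ∈ lcs L 1, l = a • x + b • y + d

/-- A filiform Lie algebra is generated, modulo the commutator ideal, by two elements of a given
spanning set. The terms of its lower central series have the smallest possible codimensions. -/
theorem exists_generators [FiniteDimensional ℝ L] (hL : finrank ℝ L = 8)
    (h7 : lcs L 7 = ⊥) (h6 : lcs L 6 ≠ ⊥)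
    {S : Set L} (hS : Submodule.span ℝ S = ⊤) :
    (∃ x ∈ S, ∃ y ∈ S, Generates x y) ∧
      ∀ k, 1 ≤ k → k < 7 → finrank ℝ (lcs L k) = finrank ℝ (lcs L (k + 1)) + 1 := by
  have hW := sup_span_lcs_one_ne_top h7 h6
  have h1 : lcs L 1 ≠ ⊤ := fun h => hW 0 (by rw [h, sup_top_eq])
  obtain ⟨x, hxS, hx⟩ := exists_mem_not_mem_of_span_eq_top hS h1
  obtain ⟨y, hyS, hy⟩ := exists_mem_not_mem_of_span_eq_top hS (hW x)
  -- The `d` inequalities bound the dimension of `lcs L 1` above by 6, and the six strict drops `e1`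
  -- to `e6` bound it below by 6. Hence all of them are sharp.
  have d1 := Submodule.finrank_lt_finrank_of_lt (lt_span_singleton_sup hx)
  have d2 := Submodule.finrank_lt_finrank_of_lt (lt_span_singleton_sup hy)
  have d3 := Submodule.finrank_le (Submodule.span ℝ {y} ⊔ (Submodule.span ℝ {x} ⊔ lcs L 1))
  have e1 : finrank ℝ (lcs L 2) < finrank ℝ (lcs L 1) :=
    finrank_lcs_strictAnti h7 h6 (by norm_num)
  have e2 : finrank ℝ (lcs L 3) < finrank ℝ (lcs L 2) :=
    finrank_lcs_strictAnti h7 h6 (by norm_num)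
  have e3 : finrank ℝ (lcs L 4) < finrank ℝ (lcs L 3) :=
    finrank_lcs_strictAnti h7 h6 (by norm_num)
  have e4 : finrank ℝ (lcs L 5) < finrank ℝ (lcs L 4) :=
    finrank_lcs_strictAnti h7 h6 (by norm_num)
  have e5 : finrank ℝ (lcs L 6) < finrank ℝ (lcs L 5) :=
    finrank_lcs_strictAnti h7 h6 (by norm_num)
  have e6 : finrank ℝ (lcs L 7) < finrank ℝ (lcs L 6) :=
    finrank_lcs_strictAnti h7 h6 (by norm_num)
  refine ⟨⟨x, hxS, y, hyS, fun l => ?_⟩, fun k hk1 hk7 => ?_⟩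
  · have hl : l ∈ Submodule.span ℝ {y} ⊔ (Submodule.span ℝ {x} ⊔ lcs L 1) := by
      have : Submodule.span ℝ {y} ⊔ (Submodule.span ℝ {x} ⊔ lcs L 1) = ⊤ :=
        Submodule.eq_top_of_finrank_eq (by omega)
      exact this ▸ Submodule.mem_top
    obtain ⟨b', hb', w, hw, rfl⟩ := Submodule.mem_sup.1 hl
    obtain ⟨a', ha', d, hd, rfl⟩ := Submodule.mem_sup.1 hw
    obtain ⟨a, rfl⟩ := Submodule.mem_span_singleton.1 ha'
    obtain ⟨b, rfl⟩ := Submodule.mem_span_singleton.1 hb'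
    exact ⟨a, b, d, hd, by abel⟩
  interval_cases k <;> simp only [Nat.reduceAdd] <;> omega

theorem exists_sub_smul_mem [FiniteDimensional ℝ L] {V W : Submodule ℝ L} (hWV : W ≤ V)
    (hd : finrank ℝ V = finrank ℝ W + 1) {v : L} (hv : v ∈ V) (hvW : v ∉ W) {u : L} (hu : u ∈ V) :
    ∃ c : ℝ, u - c • v ∈ W := by
  have h1 := Submodule.finrank_lt_finrank_of_lt (lt_span_singleton_sup hvW)
  have h2 : Submodule.span ℝ {v} ⊔ W ≤ V :=
    sup_le ((Submodule.span_singleton_le_iff_mem v V).2 hv) hWV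
  have h3 := Submodule.eq_of_le_of_finrank_le h2 (by omega)
  rw [← h3] at hu
  obtain ⟨a, ha, w, hw, rfl⟩ := Submodule.mem_sup.1 hu
  obtain ⟨c, rfl⟩ := Submodule.mem_span_singleton.1 ha
  exact ⟨c, by simpa using hw⟩

/-- If the term `C k` of the lower central series is spanned by `v` modulo `C (k + 1)`, then
`C (k + 1)` is spanned modulo `C (k + 2)` by the brackets of `v` with two generators. -/
theorem lcs_succ_le_of_generators {x y v : L} {k : ℕ} (hxy : Generates x y)
    (hv : ∀ u ∈ lcs L k, ∃ c : ℝ, u - c • v ∈ lcs L (k + 1)) (hvk : v ∈ lcs L k)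
    {W : Submodule ℝ L} (hW : lcs L (k + 2) ≤ W) (hx : ⁅x, v⁆ ∈ W) (hy : ⁅y, v⁆ ∈ W) :
    lcs L (k + 1) ≤ W := by
  refine lcs_succ_le fun l u hu => ?_
  obtain ⟨c, hc⟩ := hv u hu
  obtain ⟨a, b, d, hd, rfl⟩ := hxy l
  have e : ⁅a • x + b • y + d, u⁆ =
      ⁅a • x + b • y + d, u - c • v⁆ + (b * c) • ⁅y, v⁆ + (a * c) • ⁅x, v⁆ + c • ⁅d, v⁆ := by
    simp only [add_lie, smul_lie, lie_sub, lie_smul]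
    module
  have hdv : ⁅d, v⁆ ∈ lcs L (k + 2) := by
    have := lie_mem_lcs hd hvk
    rwa [show 1 + k + 1 = k + 2 by omega] at this
  rw [e]
  exact add_mem (add_mem (add_mem (hW (lie_mem_lcs_succ _ hc)) (W.smul_mem _ hy))
    (W.smul_mem _ hx)) (W.smul_mem _ (hW hdv))

theorem lcs_one_le_of_generators {x y : L} (hxy : Generates x y)
    {W : Submodule ℝ L} (hW : lcs L 2 ≤ W) (h : ⁅x, y⁆ ∈ W) : lcs L 1 ≤ W := by
  refine lcs_succ_le fun l u _ => ?_
  obtain ⟨a, b, d, hd, rfl⟩ := hxy l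
  obtain ⟨a', b', d', hd', rfl⟩ := hxy u
  have e : ⁅a • x + b • y + d, a' • x + b' • y + d'⁆ =
      (a * b' - b * a') • ⁅x, y⁆ + ⁅a • x + b • y + d, d'⁆ + ⁅d, a' • x + b' • y⁆ := by
    have hs : ⁅y, x⁆ = -⁅x, y⁆ := (lie_skew y x).symm
    simp only [add_lie, smul_lie, lie_add, lie_smul, lie_self, hs]
    module
  rw [e]
  exact add_mem (add_mem (W.smul_mem _ h) (hW (lie_mem_lcs_succ _ hd')))
    (hW (lie_mem_lcs_succ' hd _))

end FiliformGraded

/-! ### The chain of iterated brackets -/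

namespace FiliformGraded

open LieModule Module

variable {L : Type*} [LieRing L] [LieAlgebra ℝ L]

theorem Generates.swap {x y : L} (h : Generates x y) : Generates y x := fun l => by
  obtain ⟨a, b, d, hd, rfl⟩ := h l
  exact ⟨b, a, d, hd, by abel⟩

theorem Generates.sub_smul {x y : L} (h : Generates x y) (c : ℝ) : Generates x (y - c • x) :=
  fun l => by
    obtain ⟨a, b, d, hd, rfl⟩ := h l
    exact ⟨a + b * c, b, d, hd, by module⟩

/-- The lower central series of `L` is that of a filiform Lie algebra of dimension `8`. -/
structure LcsFiliform (L : Type*) [LieRing L] [LieAlgebra ℝ L] : Prop where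
  lcs_seven : lcs L 7 = ⊥
  not_le_succ : ∀ k < 7, ¬ lcs L k ≤ lcs L (k + 1)
  exists_sub_smul_mem : ∀ k, 1 ≤ k → k < 7 → ∀ v ∈ lcs L k, v ∉ lcs L (k + 1) →
    ∀ u ∈ lcs L k, ∃ c : ℝ, u - c • v ∈ lcs L (k + 1)

namespace LcsFiliform

/-- Since `v` spans its quotient, its brackets with the two generators span the next one, which is
nonzero. -/
theorem lie_not_mem_or (h : LcsFiliform L) {x y : L} (hxy : Generates x y) {k : ℕ} (hk1 : 1 ≤ k)
    (hk : k < 6) {v : L} (hv : v ∈ lcs L k) (hv' : v ∉ lcs L (k + 1)) :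
    ⁅x, v⁆ ∉ lcs L (k + 2) ∨ ⁅y, v⁆ ∉ lcs L (k + 2) := by
  by_contra! H
  exact h.not_le_succ (k + 1) (by omega) (lcs_succ_le_of_generators hxy
    (h.exists_sub_smul_mem k hk1 (by omega) v hv hv') hv le_rfl H.1 H.2)

theorem lie_not_mem (h : LcsFiliform L) {x y : L} (hxy : Generates x y) : ⁅x, y⁆ ∉ lcs L 2 :=
  fun H => h.not_le_succ 1 (by norm_num) (lcs_one_le_of_generators hxy le_rfl H)

theorem lie_mem (x y : L) : ⁅x, y⁆ ∈ lcs L 1 :=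
  lie_mem_lcs_succ (k := 0) x Submodule.mem_top

/-- There are homogeneous generators the second of which centralizes the second term of the lower
central series modulo the fourth one. -/
theorem exists_generators_aux (h : LcsFiliform L) {D : L →ₗ[ℝ] L}
    (hD : ∀ x y, D ⁅x, y⁆ = ⁅D x, y⁆ + ⁅x, D y⁆) {x y : L} {p q : ℝ}
    (hxy : Generates x y) (hx : D x = p • x) (hy : D y = q • y)
    (hxz : ⁅x, ⁅x, y⁆⁆ ∉ lcs L 3) :
    ∃ y : L, Generates x y ∧ D y = q • y ∧ ⁅x, ⁅x, y⁆⁆ ∉ lcs L 3 ∧ ⁅y, ⁅x, y⁆⁆ ∈ lcs L 3 := by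
  obtain ⟨c, hc⟩ := h.exists_sub_smul_mem 2 (by norm_num) (by norm_num) ⁅x, ⁅x, y⁆⁆
    (lie_mem_lcs_succ x (lie_mem x y)) hxz ⁅y, ⁅x, y⁆⁆ (lie_mem_lcs_succ y (lie_mem x y))
  have hDc := map_mem_lcs hD _ hc
  -- Subtracting the weight of `⁅y, ⁅x, y⁆⁆` leaves only a multiple of `⁅x, ⁅x, y⁆⁆`. So `c = 0`
  -- unless `p = q`, and in either case `y - c • x` is still homogeneous.
  have e : D (⁅y, ⁅x, y⁆⁆ - c • ⁅x, ⁅x, y⁆⁆) - (p + 2 * q) • (⁅y, ⁅x, y⁆⁆ - c • ⁅x, ⁅x, y⁆⁆) =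
      (c * (q - p)) • ⁅x, ⁅x, y⁆⁆ := by
    simp only [map_sub, map_smul, hD, hx, hy, smul_lie, lie_smul, lie_add]
    module
  have he := sub_mem hDc (Submodule.smul_mem _ (p + 2 * q) hc)
  rw [e] at he
  have hcq : c * (q - p) = 0 := by
    by_contra h0
    exact hxz ((Submodule.smul_mem_iff _ h0).1 he)
  have hz : ⁅x, y - c • x⁆ = ⁅x, y⁆ := by simp
  refine ⟨y - c • x, hxy.sub_smul c, ?_, ?_, ?_⟩
  · rw [map_sub, map_smul, hx, hy, ← sub_eq_zero]
    have : q • y - c • p • x - q • (y - c • x) = (c * (q - p)) • x := by module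
    rw [this, hcq, zero_smul]
  · rwa [hz]
  · rw [hz, sub_lie, smul_lie]
    exact hc

/-- At least one generator moves `⁅x, y⁆` outside `lcs L 3`; the two are swapped if necessary so
that it is the first. -/
theorem exists_generators (h : LcsFiliform L) {D : L →ₗ[ℝ] L}
    (hD : ∀ x y, D ⁅x, y⁆ = ⁅D x, y⁆ + ⁅x, D y⁆) {x y : L} {p q : ℝ} (hp : 0 < p) (hq : 0 < q)
    (hxy : Generates x y) (hx : D x = p • x) (hy : D y = q • y) :
    ∃ (x y : L) (p q : ℝ), 0 < p ∧ 0 < q ∧ Generates x y ∧ D x = p • x ∧ D y = q • y ∧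
      ⁅x, ⁅x, y⁆⁆ ∉ lcs L 3 ∧ ⁅y, ⁅x, y⁆⁆ ∈ lcs L 3 := by
  rcases h.lie_not_mem_or hxy le_rfl (by norm_num) (lie_mem x y) (h.lie_not_mem hxy) with H | H
  · obtain ⟨y', h1, h2, h3, h4⟩ := h.exists_generators_aux hD hxy hx hy H
    exact ⟨x, y', p, q, hp, hq, h1, hx, h2, h3, h4⟩
  · have H' : ⁅y, ⁅y, x⁆⁆ ∉ lcs L 3 := by
      rwa [← lie_skew y x, lie_neg, neg_mem_iff]
    obtain ⟨x', h1, h2, h3, h4⟩ := h.exists_generators_aux hD hxy.swap hy hx H'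
    exact ⟨y, x', q, p, hq, hp, h1, hy, h2, h3, h4⟩

/-- The iterated brackets of the first generator with the second one span the successive quotients
of the lower central series, with the possible exception of the last one. -/
theorem chain (h : LcsFiliform L) {x y z₃ z₄ z₅ z₆ z₇ : L} (hxy : Generates x y)
    (h₃ : ⁅x, y⁆ = z₃) (h₄ : ⁅x, z₃⁆ = z₄) (h₅ : ⁅x, z₄⁆ = z₅) (h₆ : ⁅x, z₅⁆ = z₆)
    (h₇ : ⁅x, z₆⁆ = z₇) (hz₄ : z₄ ∉ lcs L 3) (hy₃ : ⁅y, z₃⁆ ∈ lcs L 3) :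
    z₅ ∉ lcs L 4 ∧ z₆ ∉ lcs L 5 ∧ z₇ ∉ lcs L 6 ∧ ⁅z₃, z₄⁆ ∈ lcs L 5 := by
  have m₃ : z₃ ∈ lcs L 1 := h₃ ▸ lie_mem x y
  have m₄ : z₄ ∈ lcs L 2 := h₄ ▸ lie_mem_lcs_succ x m₃
  have m₅ : z₅ ∈ lcs L 3 := h₅ ▸ lie_mem_lcs_succ x m₄
  have m₆ : z₆ ∈ lcs L 4 := h₆ ▸ lie_mem_lcs_succ x m₅
  have hs (v w : L) (e : ⁅x, v⁆ = w) : ⁅y, w⁆ = ⁅x, ⁅y, v⁆⁆ - ⁅z₃, v⁆ := by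
    rw [leibniz_lie x y v, h₃, e]; abel
  have hy₄ : ⁅y, z₄⁆ ∈ lcs L 4 := by
    rw [hs _ _ h₄, lie_self, sub_zero]
    exact lie_mem_lcs_succ x hy₃
  have n₅ : z₅ ∉ lcs L 4 := by
    rw [← h₅]
    exact (h.lie_not_mem_or hxy (by norm_num) (by norm_num) m₄ hz₄).resolve_right
      (not_not_intro hy₄)
  have m₃₄ : ⁅z₃, z₄⁆ ∈ lcs L 4 := lie_mem_lcs m₃ m₄
  have hu : ⁅y, z₅⁆ ∈ lcs L 4 := lie_mem_lcs_succ y m₅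
  have hub : ⁅y, z₅⁆ + ⁅z₃, z₄⁆ ∈ lcs L 5 := by
    rw [hs _ _ h₅, sub_add_cancel]
    exact lie_mem_lcs_succ x hy₄
  have hyb : ⁅y, ⁅z₃, z₄⁆⁆ ∈ lcs L 6 := by
    rw [leibniz_lie]
    exact add_mem (lie_mem_lcs hy₃ m₄) (lie_mem_lcs m₃ hy₄)
  have hyu : ⁅y, ⁅y, z₅⁆⁆ ∈ lcs L 6 := by
    have := sub_mem (lie_mem_lcs_succ y hub) hyb
    rwa [lie_add, add_sub_cancel_right] at this
  -- The crux: otherwise `u = ⁅y, z₅⁆` spans `lcs L 4` modulo `lcs L 5`, so `z₆` is a multiple of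
  -- `u` there and `⁅y, z₆⁆` lies in `lcs L 6`. It follows that both generators send `u` into `lcs L
  -- 6`, which is impossible.
  have hu5 : ⁅y, z₅⁆ ∈ lcs L 5 := by
    by_contra hu5
    obtain ⟨c, hc⟩ := h.exists_sub_smul_mem 4 (by norm_num) (by norm_num) _ hu hu5 z₆ m₆
    have hyv : ⁅y, z₆⁆ ∈ lcs L 6 := by
      have := add_mem (lie_mem_lcs_succ y hc) (Submodule.smul_mem _ c hyu)
      rwa [lie_sub, lie_smul, sub_add_cancel] at this
    have e1 : ⁅z₃, z₅⁆ = ⁅x, ⁅z₃, z₄⁆⁆ := by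
      rw [leibniz_lie x z₃ z₄, h₄, h₅, lie_self, zero_add]
    have e2 := hs _ _ h₆
    have hxu : ⁅x, ⁅y, z₅⁆⁆ ∈ lcs L 6 := by
      have h1 := lie_mem_lcs_succ x hub
      have h2 := add_mem h1 hyv
      -- Here `⁅y, z₆⁆ = ⁅x, u⁆ - ⁅x, ⁅z₃, z₄⁆⁆`, so the terms in `⁅z₃, z₄⁆` cancel.
      have e : ⁅x, ⁅y, z₅⁆ + ⁅z₃, z₄⁆⁆ + ⁅y, z₆⁆ = (2 : ℝ) • ⁅x, ⁅y, z₅⁆⁆ := by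
        rw [e2, e1, lie_add]; module
      rw [e] at h2
      exact (Submodule.smul_mem_iff _ two_ne_zero).1 h2
    rcases h.lie_not_mem_or hxy (by norm_num) (by norm_num) hu hu5 with H | H
    · exact H hxu
    · exact H hyu
  have n₆ : z₆ ∉ lcs L 5 := by
    rw [← h₆]
    exact (h.lie_not_mem_or hxy (by norm_num) (by norm_num) m₅ n₅).resolve_right
      (not_not_intro hu5)
  have hb5 : ⁅z₃, z₄⁆ ∈ lcs L 5 := by
    simpa using sub_mem hub hu5
  have hy₆ : ⁅y, z₆⁆ ∈ lcs L 6 := by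
    rw [hs _ _ h₆]
    refine sub_mem (lie_mem_lcs_succ x hu5) ?_
    have e1 : ⁅z₃, z₅⁆ = ⁅x, ⁅z₃, z₄⁆⁆ := by
      rw [leibniz_lie x z₃ z₄, h₄, h₅, lie_self, zero_add]
    rw [e1]
    exact lie_mem_lcs_succ x hb5
  refine ⟨n₅, n₆, ?_, hb5⟩
  rw [← h₇]
  exact (h.lie_not_mem_or hxy (by norm_num) (by norm_num) m₆ n₆).resolve_right
    (not_not_intro hy₆)

end LcsFiliform

end FiliformGraded

/-! ### Homogeneous adapted families -/

namespace FiliformGraded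

open LieModule Module

variable {L : Type*} [LieRing L] [LieAlgebra ℝ L]

theorem IsFiliform.lcsFiliform (hL : finrank ℝ L = 8) (h : IsFiliform L) {S : Set L}
    (hS : Submodule.span ℝ S = ⊤) :
    LcsFiliform L ∧ ∃ x ∈ S, ∃ y ∈ S, Generates x y := by
  have := h.1
  obtain ⟨h7, h6⟩ := h.lcs_eq hL
  obtain ⟨hxy, hd⟩ := FiliformGraded.exists_generators hL h7 h6 hS
  exact ⟨⟨h7, fun k hk => not_lcs_le_succ h7 h6 hk, fun k h1 hk v hv hv' u hu =>
    FiliformGraded.exists_sub_smul_mem (lcs_antitone k.le_succ) (hd k h1 hk) hv hv' hu⟩, hxy⟩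

/-- In a basis of eigenvectors, an eigenvector has nonzero coordinates only at its own weight. -/
theorem repr_mul_sub_eq_zero {ι : Type*} (B : Basis ι ℝ L) {D : L →ₗ[ℝ] L} {w : ι → ℝ}
    (hB : ∀ i, D (B i) = w i • B i) {u : L} {c : ℝ} (hu : D u = c • u) (i : ι) :
    B.repr u i * (w i - c) = 0 := by
  have key : B.coord i ∘ₗ D = w i • B.coord i := by
    refine B.ext fun j => ?_
    rcases eq_or_ne j i with rfl | hj <;> simp [*]
  have := LinearMap.congr_fun key u
  simp only [LinearMap.comp_apply, hu, map_smul, LinearMap.smul_apply, Basis.coord_apply,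
    smul_eq_mul] at this
  linear_combination -this

namespace LcsFiliform

/-- A chain of homogeneous elements as in `LcsFiliform.chain`, completed by an element of the last
term of the lower central series, is an adapted family. -/
theorem exists_adapted_of_chain (h : LcsFiliform L) (hL : finrank ℝ L = 8) {D : L →ₗ[ℝ] L}
    (hD : ∀ x y, D ⁅x, y⁆ = ⁅D x, y⁆ + ⁅x, D y⁆) {x y z₃ z₄ z₅ z₆ z₇ z₈ : L} {p q ω ε : ℝ}
    (hxy : Generates x y) (hx : D x = p • x) (hy : D y = q • y)
    (h₃ : ⁅x, y⁆ = z₃) (h₄ : ⁅x, z₃⁆ = z₄) (h₅ : ⁅x, z₄⁆ = z₅) (h₆ : ⁅x, z₅⁆ = z₆)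
    (h₇ : ⁅x, z₆⁆ = z₇) (hz₄ : z₄ ∉ lcs L 3) (hy₃ : ⁅y, z₃⁆ ∈ lcs L 3)
    (h₈ : ⁅x, z₇⁆ = ε • z₈) (m₈ : z₈ ∈ lcs L 6) (hz₈ : z₈ ≠ 0) (hDz₈ : D z₈ = ω • z₈) :
    ∃ P : Params, P.ε = ε ∧ Adapted ![x, y, z₃, z₄, z₅, z₆, z₇, z₈] P ∧
      P.a2 * (q - 2 * p) = 0 ∧ P.a3 * (q - 3 * p) = 0 ∧ P.a4 * (q - 4 * p) = 0 ∧
      P.a5 * (ω - (2 * q + p)) = 0 ∧ P.b2 * (q - 2 * p) = 0 ∧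
      P.b3 * (ω - (2 * q + 3 * p)) = 0 ∧ P.η * (ω - (2 * q + 5 * p)) = 0 := by
  obtain ⟨n₅, n₆, n₇, m₃₄⟩ := h.chain hxy h₃ h₄ h₅ h₆ h₇ hz₄ hy₃
  have n₃ : z₃ ∉ lcs L 2 := h₃ ▸ h.lie_not_mem hxy
  have m₃ : z₃ ∈ lcs L 1 := h₃ ▸ lie_mem x y
  have m₄ : z₄ ∈ lcs L 2 := h₄ ▸ lie_mem_lcs_succ x m₃
  have m₅ : z₅ ∈ lcs L 3 := h₅ ▸ lie_mem_lcs_succ x m₄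
  have m₆ : z₆ ∈ lcs L 4 := h₆ ▸ lie_mem_lcs_succ x m₅
  have m₇ : z₇ ∈ lcs L 5 := h₇ ▸ lie_mem_lcs_succ x m₆
  have eq_zero {u : L} (hu : u ∈ lcs L 7) : u = 0 := by
    rwa [h.lcs_seven, Submodule.mem_bot] at hu
  have n₈ : z₈ ∉ lcs L 7 := fun hu => hz₈ (eq_zero hu)
  have E6 (u : L) (hu : u ∈ lcs L 6) : ∃ c : ℝ, u = c • z₈ := by
    obtain ⟨c, hc⟩ := h.exists_sub_smul_mem 6 (by norm_num) (by norm_num) z₈ m₈ n₈ u hu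
    exact ⟨c, sub_eq_zero.1 (eq_zero hc)⟩
  have E5 (u : L) (hu : u ∈ lcs L 5) : ∃ a b : ℝ, u = a • z₇ + b • z₈ := by
    obtain ⟨c, hc⟩ := h.exists_sub_smul_mem 5 (by norm_num) (by norm_num) z₇ m₇ n₇ u hu
    obtain ⟨b, hb⟩ := E6 _ hc
    exact ⟨c, b, by rw [← hb]; abel⟩
  have E4 (u : L) (hu : u ∈ lcs L 4) : ∃ a b c : ℝ, u = a • z₆ + b • z₇ + c • z₈ := by
    obtain ⟨c, hc⟩ := h.exists_sub_smul_mem 4 (by norm_num) (by norm_num) z₆ m₆ n₆ u hu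
    obtain ⟨a, b, hb⟩ := E5 _ hc
    exact ⟨c, a, b, by rw [add_assoc, ← hb]; abel⟩
  have E3 (u : L) (hu : u ∈ lcs L 3) :
      ∃ a b c d : ℝ, u = a • z₅ + b • z₆ + c • z₇ + d • z₈ := by
    obtain ⟨c, hc⟩ := h.exists_sub_smul_mem 3 (by norm_num) (by norm_num) z₅ m₅ n₅ u hu
    obtain ⟨a, b, d, hb⟩ := E4 _ hc
    exact ⟨c, a, b, d, by rw [add_assoc, add_assoc, ← add_assoc (a • z₆), ← hb]; abel⟩
  have hspan : ⊤ ≤ Submodule.span ℝ (Set.range ![x, y, z₃, z₄, z₅, z₆, z₇, z₈]) := by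
    set f := ![x, y, z₃, z₄, z₅, z₆, z₇, z₈] with hf
    have hm (i : Fin 8) (c : ℝ) : c • f i ∈ Submodule.span ℝ (Set.range f) :=
      Submodule.smul_mem _ _ (Submodule.subset_span ⟨i, rfl⟩)
    intro u _
    obtain ⟨a, b, d, hd, rfl⟩ := hxy u
    obtain ⟨c₃, hc₃⟩ := h.exists_sub_smul_mem 1 (by norm_num) (by norm_num) z₃ m₃ n₃ d hd
    obtain ⟨c₄, hc₄⟩ := h.exists_sub_smul_mem 2 (by norm_num) (by norm_num) z₄ m₄ hz₄ _ hc₃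
    obtain ⟨c₅, c₆, c₇, c₈, e⟩ := E3 _ hc₄
    have e' : d = c₃ • z₃ + c₄ • z₄ + (c₅ • z₅ + c₆ • z₆ + c₇ • z₇ + c₈ • z₈) := by
      rw [← e]; abel
    rw [e']
    exact add_mem (add_mem (hm 0 a) (hm 1 b)) (add_mem (add_mem (hm 2 c₃) (hm 3 c₄))
      (add_mem (add_mem (add_mem (hm 4 c₅) (hm 5 c₆)) (hm 6 c₇)) (hm 7 c₈)))
  -- The filtration degree of each bracket limits its expansion, which gives the shape required by
  -- `Adapted`.
  obtain ⟨a2, a3, a4, a5, r₁₂⟩ := E3 _ hy₃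
  obtain ⟨b2, b3, r₂₃⟩ := E5 _ m₃₄
  obtain ⟨η, r₃₄⟩ := E6 _ (lie_mem_lcs m₄ m₅)
  have hP : Adapted ![x, y, z₃, z₄, z₅, z₆, z₇, z₈] ⟨ε, η, a2, b2, a3, b3, a4, a5⟩ :=
    { span := hspan
      l01 := h₃
      l02 := h₄
      l03 := h₅
      l04 := h₆
      l05 := h₇
      l06 := h₈
      l07 := eq_zero (lie_mem_lcs_succ x m₈)
      l12 := r₁₂
      l17 := eq_zero (lie_mem_lcs_succ y m₈)
      l23 := r₂₃
      l34 := r₃₄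
      l45 := eq_zero (lcs_antitone (by norm_num) (lie_mem_lcs m₅ m₆))
      l56 := eq_zero (lcs_antitone (by norm_num) (lie_mem_lcs m₆ m₇)) }
  have D₃ : D z₃ = (q + p) • z₃ := by
    rw [← h₃, hD, hx, hy, smul_lie, lie_smul]; module
  have D₄ : D z₄ = (q + 2 * p) • z₄ := by
    rw [← h₄, hD, hx, D₃, smul_lie, lie_smul]; module
  have D₅ : D z₅ = (q + 3 * p) • z₅ := by
    rw [← h₅, hD, hx, D₄, smul_lie, lie_smul]; module
  have D₆ : D z₆ = (q + 4 * p) • z₆ := by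
    rw [← h₆, hD, hx, D₅, smul_lie, lie_smul]; module
  have D₇ : D z₇ = (q + 5 * p) • z₇ := by
    rw [← h₇, hD, hx, D₆, smul_lie, lie_smul]; module
  have D₁₂ : D ⁅y, z₃⁆ = (2 * q + p) • ⁅y, z₃⁆ := by
    rw [hD, hy, D₃, smul_lie, lie_smul]; module
  have D₂₃ : D ⁅z₃, z₄⁆ = (2 * q + 3 * p) • ⁅z₃, z₄⁆ := by
    rw [hD, D₃, D₄, smul_lie, lie_smul]; module
  have D₃₄ : D ⁅z₄, z₅⁆ = (2 * q + 5 * p) • ⁅z₄, z₅⁆ := by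
    rw [hD, D₄, D₅, smul_lie, lie_smul]; module
  let B := hP.basis hL
  have hB (i : Fin 8) : B i = ![x, y, z₃, z₄, z₅, z₆, z₇, z₈] i := by
    simp [B, Adapted.basis]
  have hDB (i : Fin 8) : D (B i) = ![p, q, q + p, q + 2 * p, q + 3 * p, q + 4 * p, q + 5 * p, ω] i •
      B i := by
    rw [hB]
    fin_cases i <;> assumption
  have b4 : z₅ = B 4 := (hB 4).symm
  have b5 : z₆ = B 5 := (hB 5).symm
  have b6 : z₇ = B 6 := (hB 6).symm
  have b7 : z₈ = B 7 := (hB 7).symm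
  -- A constant survives only if the weight of the bracket equals that of the basis vector it
  -- multiplies.
  have R₁₂ := repr_mul_sub_eq_zero B hDB D₁₂
  have R₂₃ := repr_mul_sub_eq_zero B hDB D₂₃
  have R₃₄ := repr_mul_sub_eq_zero B hDB D₃₄
  rw [r₁₂, b4, b5, b6, b7] at R₁₂
  rw [r₂₃, b6, b7] at R₂₃
  rw [r₃₄, b7] at R₃₄
  simp only [map_add, map_smul, Basis.repr_self, Finsupp.add_apply, Finsupp.smul_apply,
    Finsupp.single_apply, smul_eq_mul] at R₁₂ R₂₃ R₃₄
  have i4 := R₁₂ 4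
  have i5 := R₁₂ 5
  have i6 := R₁₂ 6
  have i7 := R₁₂ 7
  have j6 := R₂₃ 6
  have j7 := R₂₃ 7
  have k7 := R₃₄ 7
  simp only [Matrix.cons_val, Fin.reduceEq, if_true, if_false, mul_one, mul_zero, add_zero,
    zero_add] at i4 i5 i6 i7 j6 j7 k7
  refine ⟨_, rfl, hP, ?_, ?_, ?_, i7, ?_, j7, k7⟩
  · linear_combination -i4
  · linear_combination -i5
  · linear_combination -i6
  · linear_combination -j6

/-- A filiform Lie algebra with a gradation has an adapted family of homogeneous elements. -/
theorem exists_adapted (h : LcsFiliform L) (hL : finrank ℝ L = 8) {D : L →ₗ[ℝ] L}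
    (hD : ∀ x y, D ⁅x, y⁆ = ⁅D x, y⁆ + ⁅x, D y⁆) {x y : L} {p q : ℝ} (hp : 0 < p) (hq : 0 < q)
    (hxy : Generates x y) (hx : D x = p • x) (hy : D y = q • y) :
    ∃ (f : Fin 8 → L) (P : Params) (r : ℝ), Adapted f P ∧
      P.a2 * (r - 2) = 0 ∧ P.a3 * (r - 3) = 0 ∧ P.a4 * (r - 4) = 0 ∧ P.a5 * (r - 5) = 0 ∧
      P.b2 * (r - 2) = 0 ∧ P.b3 * (r - 3) = 0 ∧
      (P.ε = 1 ∧ P.η * (r - 1) = 0 ∨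
        P.ε = 0 ∧ P.η = -1 ∧ P.a5 = 0 ∧ P.b3 = 0 ∧ P.b2 = -2 * P.a2) := by
  obtain ⟨x, y, p, q, hp, hq, hxy, hx, hy, hz₄, hy₃⟩ := h.exists_generators hD hp hq hxy hx hy
  have resc {a c : ℝ} (e : a * (q - c * p) = 0) : a * (q / p - c) = 0 := by
    have : a * (q / p - c) = a * (q - c * p) / p := by field_simp
    rw [this, e, zero_div]
  obtain ⟨z₃, h₃⟩ : ∃ z, ⁅x, y⁆ = z := ⟨_, rfl⟩
  rw [h₃] at hz₄ hy₃
  obtain ⟨z₄, h₄⟩ : ∃ z, ⁅x, z₃⁆ = z := ⟨_, rfl⟩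
  obtain ⟨z₅, h₅⟩ : ∃ z, ⁅x, z₄⁆ = z := ⟨_, rfl⟩
  obtain ⟨z₆, h₆⟩ : ∃ z, ⁅x, z₅⁆ = z := ⟨_, rfl⟩
  obtain ⟨z₇, h₇⟩ : ∃ z, ⁅x, z₆⁆ = z := ⟨_, rfl⟩
  rw [h₄] at hz₄
  obtain ⟨-, -, n₇, -⟩ := h.chain hxy h₃ h₄ h₅ h₆ h₇ hz₄ hy₃
  have m₇ : z₇ ∈ lcs L 5 := by
    rw [← h₇, ← h₆, ← h₅, ← h₄, ← h₃]
    exact lie_mem_lcs_succ _ (lie_mem_lcs_succ _ (lie_mem_lcs_succ _ (lie_mem_lcs_succ _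
      (lie_mem _ _))))
  have D₇ : D z₇ = (q + 5 * p) • z₇ := by
    rw [← h₇, ← h₆, ← h₅, ← h₄, ← h₃]
    simp only [hD, hx, hy, smul_lie, lie_smul, lie_add]
    module
  -- The last term of the series is spanned by a bracket of `z₇` with `x` or with `y`; which one
  -- decides `ε` and the weight `ω`.
  by_cases hx₇ : ⁅x, z₇⁆ = 0
  · have hy₇ : -⁅y, z₇⁆ ≠ 0 := by
      intro hy₇
      rw [neg_eq_zero] at hy₇
      have := h.lie_not_mem_or hxy (by norm_num) (by norm_num) m₇ n₇
      simp [hx₇, hy₇] at this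
    -- The sign in `z₈ = -⁅y, z₇⁆` yields `η = -1`, as in the table.
    have D₈ : D (-⁅y, z₇⁆) = (2 * q + 5 * p) • -⁅y, z₇⁆ := by
      rw [map_neg, hD, D₇, hy, smul_lie, lie_smul]; module
    obtain ⟨P, hε, hP, h2, h3, h4, h5, h6, h7, -⟩ := h.exists_adapted_of_chain hL hD hxy hx hy h₃ h₄
      h₅ h₆ h₇ hz₄ hy₃ (ε := 0) (by rw [hx₇, zero_smul]) (neg_mem (lie_mem_lcs_succ y m₇)) hy₇ D₈
    have hη : P.η = -1 := by
      have e : ⁅y, z₇⁆ = P.η • -⁅y, z₇⁆ := hP.l16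
      have : (P.η + 1) • -⁅y, z₇⁆ = 0 := by
        rw [add_smul, ← e, one_smul, add_neg_cancel]
      linarith [(smul_eq_zero.1 this).resolve_right hy₇]
    -- As `p > 0`, the weight `2 * q + 5 * p` of `z₈` differs from `2 * q + p` and `2 * q + 3 * p`,
    -- so `a5` and `b3` vanish.
    have ha5 : P.a5 = 0 := by
      refine (mul_eq_zero.1 h5).resolve_right ?_
      intro e; linarith
    have hb3 : P.b3 = 0 := by
      refine (mul_eq_zero.1 h7).resolve_right ?_
      intro e; linarith
    have hJ := hP.jacobi_relation hy₇ hε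
    rw [hη] at hJ
    refine ⟨_, P, q / p, hP, resc h2, resc h3, resc h4, by simp [ha5], resc h6, by simp [hb3],
      Or.inr ⟨hε, hη, ha5, hb3, by linarith⟩⟩
  · have D₈ : D ⁅x, z₇⁆ = (q + 6 * p) • ⁅x, z₇⁆ := by
      rw [hD, D₇, hx, smul_lie, lie_smul]; module
    obtain ⟨P, hε, hP, h2, h3, h4, h5, h6, h7, h8⟩ := h.exists_adapted_of_chain hL hD hxy hx hy h₃
      h₄ h₅ h₆ h₇ hz₄ hy₃ (ε := 1) (one_smul _ _).symm (lie_mem_lcs_succ x m₇) hx₇ D₈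
    refine ⟨_, P, q / p, hP, resc h2, resc h3, resc h4, resc ?_, resc h6, resc ?_,
      Or.inl ⟨hε, resc ?_⟩⟩
    · linear_combination -h5
    · linear_combination -h7
    · linear_combination -h8

end LcsFiliform

end FiliformGraded

/-! ### Normal forms and the classification -/

namespace FiliformGraded

open Module

variable {L : Type*} [LieRing L] [LieAlgebra ℝ L]

namespace Adapted

variable {f : Fin 8 → L} {P : Params}

/-- A common factor on `f 1` to `f 6` preserves the chain under `f 0`, and `f 7` scales
independently. Taking `d = c` keeps `ε`; taking `d = c ^ 2` keeps `η`. -/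
theorem rescale (h : Adapted f P) {c d : ℝ} (hc : c ≠ 0) (hd : d ≠ 0) :
    Adapted ![f 0, c • f 1, c • f 2, c • f 3, c • f 4, c • f 5, c • f 6, d • f 7]
      ⟨c * P.ε / d, c ^ 2 * P.η / d, c * P.a2, c * P.b2, c * P.a3, c ^ 2 * P.b3 / d, c * P.a4,
        c ^ 2 * P.a5 / d⟩ where
  span := by
    refine h.span.trans (Submodule.span_le.2 ?_)
    rintro _ ⟨i, rfl⟩
    have key (a : ℝ) (ha : a ≠ 0) (e : ![f 0, c • f 1, c • f 2, c • f 3, c • f 4, c • f 5, c • f 6,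
        d • f 7] i = a • f i) : f i ∈ Submodule.span ℝ (Set.range ![f 0, c • f 1, c • f 2, c • f 3,
          c • f 4, c • f 5, c • f 6, d • f 7]) := by
      rw [← inv_smul_smul₀ ha (f i), ← e]
      exact Submodule.smul_mem _ _ (Submodule.subset_span ⟨i, rfl⟩)
    fin_cases i
    exacts [key 1 one_ne_zero (one_smul _ _).symm, key c hc rfl, key c hc rfl, key c hc rfl,
      key c hc rfl, key c hc rfl, key c hc rfl, key d hd rfl]
  l01 := by simp [h.l01]
  l02 := by simp [h.l02]
  l03 := by simp [h.l03]
  l04 := by simp [h.l04]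
  l05 := by simp [h.l05]
  l06 := by
    simp only [Matrix.cons_val, lie_smul, h.l06, smul_smul]
    rw [div_mul_cancel₀ _ hd]
  l07 := by simp [h.l07]
  l12 := by
    simp only [Matrix.cons_val, lie_smul, smul_lie, h.l12, smul_add, smul_smul]
    rw [div_mul_cancel₀ _ hd]
    module
  l17 := by simp [h.l17]
  l23 := by
    simp only [Matrix.cons_val, lie_smul, smul_lie, h.l23, smul_add, smul_smul]
    rw [div_mul_cancel₀ _ hd]
    module
  l34 := by
    simp only [Matrix.cons_val, lie_smul, smul_lie, h.l34, smul_smul]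
    rw [div_mul_cancel₀ _ hd]
    module
  l45 := by simp [h.l45]
  l56 := by simp [h.l56]

/-- An adapted family of the algebra `m1` of the table, from one whose first and seventh members
commute. -/
theorem m1_of_eq (h : Adapted f P) (hP : P = ⟨0, -1, 0, 0, 0, 0, 0, 0⟩) :
    Adapted ![f 0 - f 1, -f 1, -f 2, -f 3, -f 4, -f 5, -f 6, -f 7] TableName.m1.params where
  span := by
    refine h.span.trans (Submodule.span_le.2 ?_)
    set g := ![f 0 - f 1, -f 1, -f 2, -f 3, -f 4, -f 5, -f 6, -f 7]
    have hg (i : Fin 8) : g i ∈ Submodule.span ℝ (Set.range g) := Submodule.subset_span ⟨i, rfl⟩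
    have key (i : Fin 8) (e : g i = -f i) : f i ∈ Submodule.span ℝ (Set.range g) := by
      rw [← neg_neg (f i), ← e]
      exact neg_mem (hg i)
    rintro _ ⟨i, rfl⟩
    fin_cases i
    · have e : f 0 = g 0 - g 1 := by simp [g]
      change f 0 ∈ Submodule.span ℝ (Set.range g)
      rw [e]
      exact sub_mem (hg 0) (hg 1)
    all_goals exact key _ rfl
  l01 := by simp [h.l01]
  l02 := by simp [h.l02, h.l12, hP]
  l03 := by simp [h.l03, h.l13, hP]
  l04 := by simp [h.l04, h.l14, hP]
  l05 := by simp [h.l05, h.l15, hP]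
  -- Since `⁅f 1, f 6⁆ = -f 7`, the new first vector `f 0 - f 1` continues the chain to the end,
  -- which turns `ε = 0` into `ε = 1`.
  l06 := by simp [h.l06, h.l16, hP, TableName.params]
  l07 := by simp [h.l07, h.l17]
  l12 := by simp [h.l12, hP, TableName.params]
  l17 := by simp [h.l17]
  l23 := by simp [h.l23, hP, TableName.params]
  l34 := by simp [h.l34, hP, TableName.params]
  l45 := by simp [h.l45]
  l56 := by simp [h.l56]

/-- A nonzero constant fixes `r` and thereby kills all constants of other indices. Each `b_k` is
tested before `a_k`, because the curves are normalized by `b_k = 1`. -/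
theorem exists_equiv_of_ε_eq_one (h : Adapted f P) (hL : finrank ℝ L = 8) {r : ℝ}
    (ha2 : P.a2 * (r - 2) = 0) (ha3 : P.a3 * (r - 3) = 0) (ha4 : P.a4 * (r - 4) = 0)
    (ha5 : P.a5 * (r - 5) = 0) (hb2 : P.b2 * (r - 2) = 0) (hb3 : P.b3 * (r - 3) = 0)
    (hε : P.ε = 1) (hη : P.η * (r - 1) = 0) : ∃ s, Nonempty (L ≃ₗ⁅ℝ⁆ TableAlgebra s) := by
  have fin (s : TableName) (c : ℝ) (hc : c ≠ 0) (hs : (⟨1, c * P.η, c * P.a2, c * P.b2, c * P.a3,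
      c * P.b3, c * P.a4, c * P.a5⟩ : Params) = s.params) :
      ∃ s, Nonempty (L ≃ₗ⁅ℝ⁆ TableAlgebra s) := by
    refine ⟨s, ⟨(h.rescale hc hc).equivTable hL s ?_⟩⟩
    rw [← hs, hε]
    have e (a : ℝ) : c ^ 2 * a / c = c * a := by field_simp
    rw [e, e, e, mul_one, div_self hc]
  have r_eq {a c : ℝ} (e : a * (r - c) = 0) (h0 : a ≠ 0) : r = c :=
    sub_eq_zero.1 ((mul_eq_zero.1 e).resolve_left h0)
  by_cases hη0 : P.η = 0
  · by_cases hb20 : P.b2 = 0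
    · by_cases ha20 : P.a2 = 0
      · by_cases hb30 : P.b3 = 0
        · by_cases ha30 : P.a3 = 0
          · by_cases ha40 : P.a4 = 0
            · by_cases ha50 : P.a5 = 0
              · refine fin .m0 1 one_ne_zero ?_
                simp [TableName.params, *]
              · obtain rfl := r_eq ha5 ha50
                refine fin .h1 P.a5⁻¹ (inv_ne_zero ha50) ?_
                norm_num at *
                simp [TableName.params, *]
            · obtain rfl := r_eq ha4 ha40
              refine fin .d1 P.a4⁻¹ (inv_ne_zero ha40) ?_
              norm_num at *
              simp [TableName.params, *]
          · obtain rfl := r_eq ha3 ha30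
            refine fin .c10 P.a3⁻¹ (inv_ne_zero ha30) ?_
            norm_num at *
            simp [TableName.params, *]
        · obtain rfl := r_eq hb3 hb30
          -- The table has `b3 = 1` and `a3 = t + 1`, so `t` is read off from the ratio of `a3` to
          -- `b3`.
          refine fin (.a (P.b3⁻¹ * P.a3 - 1)) P.b3⁻¹ (inv_ne_zero hb30) ?_
          norm_num at *
          simp [TableName.params, *]
      · obtain rfl := r_eq ha2 ha20
        refine fin .m2 P.a2⁻¹ (inv_ne_zero ha20) ?_
        norm_num at *
        simp [TableName.params, *]
    · obtain rfl := r_eq hb2 hb20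
      -- Likewise `b2 = 1` and `a2 = 2 + α` in the table.
      refine fin (.g (P.b2⁻¹ * P.a2 - 2)) P.b2⁻¹ (inv_ne_zero hb20) ?_
      norm_num at *
      simp [TableName.params, *]
  · obtain rfl := r_eq hη hη0
    refine fin .m1 P.η⁻¹ (inv_ne_zero hη0) ?_
    norm_num at *
    simp [TableName.params, *]

theorem exists_equiv_of_ε_eq_zero (h : Adapted f P) (hL : finrank ℝ L = 8) {r : ℝ}
    (ha2 : P.a2 * (r - 2) = 0) (ha3 : P.a3 * (r - 3) = 0) (ha4 : P.a4 * (r - 4) = 0)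
    (hε : P.ε = 0) (hη : P.η = -1) (ha5 : P.a5 = 0) (hb3 : P.b3 = 0) (hb2 : P.b2 = -2 * P.a2) :
    ∃ s, Nonempty (L ≃ₗ⁅ℝ⁆ TableAlgebra s) := by
  have fin (s : TableName) (c : ℝ) (hc : c ≠ 0) (hs : (⟨0, -1, c * P.a2, c * (-2 * P.a2), c * P.a3,
      0, c * P.a4, 0⟩ : Params) = s.params) :
      ∃ s, Nonempty (L ≃ₗ⁅ℝ⁆ TableAlgebra s) := by
    refine ⟨s, ⟨(h.rescale hc (pow_ne_zero 2 hc)).equivTable hL s ?_⟩⟩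
    rw [← hs, hε, hη, ha5, hb3, hb2]
    have e : c ^ 2 * -1 / c ^ 2 = -1 := by field_simp
    simp only [e, mul_zero, zero_div]
  have r_eq {a c : ℝ} (e : a * (r - c) = 0) (h0 : a ≠ 0) : r = c :=
    sub_eq_zero.1 ((mul_eq_zero.1 e).resolve_left h0)
  by_cases ha20 : P.a2 = 0
  · by_cases ha30 : P.a3 = 0
    · by_cases ha40 : P.a4 = 0
      -- With no further constants the algebra is `m1` in another basis, so this case adds nothing
      -- to the list.
      · refine ⟨.m1, ⟨(h.m1_of_eq ?_).equivTable hL .m1 rfl⟩⟩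
        obtain ⟨ε, η, a2, b2, a3, b3, a4, a5⟩ := P
        simp_all
      · obtain rfl := r_eq ha4 ha40
        refine fin .s1 P.a4⁻¹ (inv_ne_zero ha40) ?_
        norm_num at *
        simp [TableName.params, *]
    · obtain rfl := r_eq ha3 ha30
      refine fin .k1 P.a3⁻¹ (inv_ne_zero ha30) ?_
      norm_num at *
      simp [TableName.params, *]
  · obtain rfl := r_eq ha2 ha20
    -- This scale makes `a2 = -1 / 2`, and hence `b2 = -2 * a2 = 1`.
    refine fin .b (-1 / 2 * P.a2⁻¹) (mul_ne_zero (by norm_num) (inv_ne_zero ha20)) ?_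
    have e1 : -1 / 2 * P.a2⁻¹ * P.a2 = -1 / 2 := by field_simp
    have e2 : -1 / 2 * P.a2⁻¹ * (-2 * P.a2) = 1 := by field_simp
    have e3 : P.a3 = 0 := by norm_num at ha3; exact ha3
    have e4 : P.a4 = 0 := by norm_num at ha4; exact ha4
    rw [e1, e2, e3, e4]
    simp [TableName.params]

end Adapted

/-- Every filiform Lie algebra of dimension `8` with a gradation is in the table. -/
theorem exists_equiv_tableAlgebra (hL : finrank ℝ L = 8) (hf : IsFiliform L)
    (hg : AdmitsNGradation L) : ∃ s, Nonempty (L ≃ₗ⁅ℝ⁆ TableAlgebra s) := by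
  obtain ⟨D, hD, hspan⟩ := hg.exists_derivation
  obtain ⟨h, x, ⟨p, hp, hx⟩, y, ⟨q, hq, hy⟩, hxy⟩ := hf.lcsFiliform hL hspan
  obtain ⟨f, P, r, hP, ha2, ha3, ha4, ha5, hb2, hb3, hA | hB⟩ :=
    h.exists_adapted hL hD hp hq hxy hx hy
  · exact hP.exists_equiv_of_ε_eq_one hL ha2 ha3 ha4 ha5 hb2 hb3 hA.1 hA.2
  · exact hP.exists_equiv_of_ε_eq_zero hL ha2 ha3 ha4 hB.1 hB.2.1 hB.2.2.1 hB.2.2.2.1 hB.2.2.2.2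

end FiliformGraded

theorem mainTheorem1 :
    (∀ (L : Type*) [LieRing L] [LieAlgebra ℝ L], Module.finrank ℝ L = 8 →
      FiliformGraded.IsFiliform L → FiliformGraded.AdmitsNGradation L →
        ∃! s : FiliformGraded.TableName, Nonempty (L ≃ₗ⁅ℝ⁆ FiliformGraded.TableAlgebra s)) ∧
    (∀ s : FiliformGraded.TableName, Module.finrank ℝ (FiliformGraded.TableAlgebra s) = 8 ∧
      FiliformGraded.IsFiliform (FiliformGraded.TableAlgebra s) ∧
      FiliformGraded.AdmitsNGradation (FiliformGraded.TableAlgebra s)) := by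
  refine ⟨fun L _ _ hL hf hg => ?_, fun s => ⟨FiliformGraded.TableAlgebra.finrank_eq s,
    FiliformGraded.TableAlgebra.isFiliform s, FiliformGraded.TableAlgebra.admitsNGradation s⟩⟩
  obtain ⟨s, ⟨φ⟩⟩ := FiliformGraded.exists_equiv_tableAlgebra hL hf hg
  exact ⟨s, ⟨φ⟩, fun s' ⟨ψ⟩ => FiliformGraded.TableName.eq_of_equiv (ψ.symm.trans φ)⟩
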